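/- **Setting.** Let $\Omega\subseteq\mathbb R^3$ be open, with coordinates $(x,\tau,t)$, and let $D=\partial/\partial x$. Functions are smooth complex functions on $\Omega$; matrix functions have such entries. The integration $f\mapsto D^{-1}\{f\}$ of functions is realised by a linear map together with a subalgebra $F$ of $C^\infty(\Omega)$, an ideal $I\subseteq F$ of $F$, and $F$-submodules $P,Q$ of $C^\infty(\Omega)$ with $Q\cdot P\subseteq I$, all stable under $\partial_x,\partial_\tau,\partial_t$, such that $D^{-1}\{I\}\subseteq I$ and $D\{D^{-1}\{f\}\}=f=D^{-1}\{D\{f\}\}$ for $f\in I$. (For instance, $I=P=Q$ consists of functions vanishing exponentially with all derivatives as $x\to-\infty$, and $D^{-1}\{f\}=\int_{-\infty}^x f$.) An operator without braces is an element of the algebra of formal matrix pseudo-differential operators in $D$, polynomial in $\partial_\tau,\partial_t$; $A\{h\}$ denotes the action of an integro-differential operator on a matrix function $h$, with $(fD^{-1}g^{\top})\{h\}=fD^{-1}\{g^\top h\}$; and $A^\tau$ is the formal transpose: $u^\tau=u^\top$ for a matrix function $u$, $D^\tau=-D$, $\partial_\tau^\tau=-\partial_\tau$, $\partial_t^\tau=-\partial_t$,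 $(fD^{-1}g^\top)^\tau=-gD^{-1}f^\top$, $(AB)^\tau=B^\tau A^\tau$. Let $k,n,l\ge 0$, $\alpha,\beta,c\in\mathbb C$, let $u_0,\dots,u_k,v_0,\dots,v_n$ be $N\times N$ matrix functions with entries in $F$, $\mathbf q$ and $\mathbf r$ be $N\times m$ matrix functions with entries in $P$ and $Q$ respectively, $\mathcal M_0\in\mathrm{Mat}_m(\mathbb C)$, and $$L=\beta\partial_\tau-\sum_{j=0}^k u_jD^j-\mathbf q\mathcal M_0D^{-1}\mathbf r^\top,\qquad M=\alpha\partial_t-\sum_{i=0}^n v_iD^i-c\sum_{j=0}^l\mathbf q[j]\mathcal M_0D^{-1}\mathbf r[l-j]^\top,\qquad \tilde M=M-cL^{l+1},$$ where $\mathbf q[j]=L^j\{\mathbf q\}$, $\mathbf r[j]=(L^\tau)^j\{\mathbf r\}$. Let $\varphi,\psi$ be $N\times K$ matrix functions with entries in $P$ and $Q$ respectively, let $\Lambda,\tilde\Lambda\in\mathrm{Mat}_K(\mathbb C)$, let $C\in\mathrm{Mat}_K(\mathbb C)$ be nondegenerate, and suppose that $\Delta=C+D^{-1}\{\psi^\top\varphi\}$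 is invertible with the entries of $\Delta^{-1}$ in $F$. Put $$W=I-\varphi\Delta^{-1}D^{-1}\psi^\top,\quad W^{-1}=I+\varphi D^{-1}\Delta^{-1}\psi^\top,\quad \Phi=\varphi\Delta^{-1},\quad \Psi=\psi(\Delta^{-1})^\top,\quad \mathcal M_1=C\Lambda-\tilde\Lambda^\top C,$$ $\hat L=WLW^{-1}$, $\hat M=WMW^{-1}$, $\hat{\mathbf q}=W\{\mathbf q\}$, $\hat{\mathbf r}=(W^{-1})^\tau\{\mathbf r\}$, $\hat{\mathbf q}[j]=\hat L^j\{\hat{\mathbf q}\}$, $\hat{\mathbf r}[j]=(\hat L^\tau)^j\{\hat{\mathbf r}\}$, $\Phi[j]=\hat L^j\{\Phi\}$, $\Psi[j]=(\hat L^\tau)^j\{\Psi\}$. **Theorem.** $W$ and $W^{-1}$ are inverse to each other. If $$L\{\varphi\}=\varphi\Lambda,\quad L^\tau\{\psi\}=\psi\tilde\Lambda,\quad M\{\varphi\}=c\,\varphi\Lambda^{l+1},\quad M^\tau\{\psi\}=c\,\psi\tilde\Lambda^{l+1},$$ then there are $N\times N$ matrix functions $\hat u_j$ and $\hat v_i$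 (for the given integration, $\hat u_0,\dots,\hat u_k$ determined by $C,\varphi,\psi,u_0,\dots,u_k$ only, and $\hat v_0,\dots,\hat v_n$ in the same way by $C,\varphi,\psi,v_0,\dots,v_n$ only) such that $$\hat L=\beta\partial_\tau-\sum_{j=0}^k\hat u_jD^j-\hat{\mathbf q}\mathcal M_0D^{-1}\hat{\mathbf r}^\top+\Phi\mathcal M_1D^{-1}\Psi^\top,$$ $$\hat M=\alpha\partial_t-\sum_{i=0}^n\hat v_iD^i-c\sum_{j=0}^l\hat{\mathbf q}[j]\mathcal M_0D^{-1}\hat{\mathbf r}[l-j]^\top+c\sum_{s=0}^l\Phi[s]\mathcal M_1D^{-1}\Psi[l-s]^\top,$$ $$W\tilde MW^{-1}=\hat M-c\,\hat L^{l+1}.$$ -/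

import Mathlib

open scoped ContDiff

noncomputable section

namespace BDT

/-! ### Smooth functions of `(x, τ, t)` and their partial derivatives -/

section Smooth

variable (Ω : TopologicalSpace.Opens (Fin 3 → ℝ))

/-- Extension by zero of a function on `Ω` (only its values on the open set `Ω` matter). -/
def extZero (f : Ω → ℂ) : (Fin 3 → ℝ) → ℂ := Function.extend Subtype.val f 0

theorem extZero_apply (f : Ω → ℂ) (p : Ω) : extZero Ω f p = f p :=
  Subtype.val_injective.extend_apply f 0 p

theorem extZero_apply_mem (f : Ω → ℂ) {p : Fin 3 → ℝ} (hp : p ∈ Ω) : extZero Ω f p = f ⟨p, hp⟩ :=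
  extZero_apply Ω f ⟨p, hp⟩

/-- The algebra `C^∞(Ω, ℂ)` of smooth complex functions of `(x, τ, t) ∈ Ω ⊆ ℝ³`. -/
def smoothFns : Subalgebra ℂ (Ω → ℂ) where
  carrier := {f | ContDiffOn ℝ ∞ (extZero Ω f) Ω}
  mul_mem' {f g} hf hg := (ContDiffOn.mul hf hg).congr fun p hp => by
    simp [extZero_apply_mem Ω _ hp]
  add_mem' {f g} hf hg := (ContDiffOn.add hf hg).congr fun p hp => by
    simp [extZero_apply_mem Ω _ hp]
  algebraMap_mem' c := (contDiffOn_const (c := c)).congr fun p hp => by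
    simp [extZero_apply_mem Ω _ hp]

theorem differentiableAt_extZero (f : smoothFns Ω) (p : Ω) :
    DifferentiableAt ℝ (extZero Ω f) p :=
  ((show ContDiffOn ℝ ∞ (extZero Ω f) Ω from f.2).contDiffAt
    (Ω.isOpen.mem_nhds p.2)).differentiableAt (by simp)

theorem fderiv_extZero_congr {f : Ω → ℂ} {g : (Fin 3 → ℝ) → ℂ}
    (h : ∀ p (hp : p ∈ Ω), f ⟨p, hp⟩ = g p) (p : Ω) :
    fderiv ℝ (extZero Ω f) p = fderiv ℝ g p :=
  Filter.EventuallyEq.fderiv_eq <| by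
    filter_upwards [Ω.isOpen.mem_nhds p.2] with y hy
    rw [extZero_apply_mem Ω f hy, h y hy]

/-- The partial derivative in the `i`-th coordinate. -/
def partialFn (i : Fin 3) (f : smoothFns Ω) : smoothFns Ω :=
  ⟨fun p => fderiv ℝ (extZero Ω f) p (Pi.single i 1), by
    have h : ContDiffOn ℝ ∞ (fderiv ℝ (extZero Ω f)) Ω :=
      (show ContDiffOn ℝ ∞ (extZero Ω f) Ω from f.2).fderiv_of_isOpen Ω.isOpen (by simp)
    exact (h.clm_apply contDiffOn_const).congr fun p hp => by
      rw [extZero_apply_mem Ω _ hp]⟩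

/-- The partial derivative in the `i`-th coordinate, as a derivation of `C^∞(Ω, ℂ)`. -/
def pderiv (i : Fin 3) : Derivation ℂ (smoothFns Ω) (smoothFns Ω) :=
  Derivation.mk'
    { toFun := partialFn Ω i
      map_add' := fun f g => by
        ext p
        change fderiv ℝ (extZero Ω _) p _ = fderiv ℝ (extZero Ω f) p _ + fderiv ℝ (extZero Ω g) p _
        rw [fderiv_extZero_congr Ω (g := extZero Ω f + extZero Ω g)
          (fun y hy => by simp [extZero_apply_mem Ω _ hy]),
          fderiv_add (differentiableAt_extZero Ω f p) (differentiableAt_extZero Ω g p)]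
        rfl
      map_smul' := fun c f => by
        ext p
        change fderiv ℝ (extZero Ω _) p _ = c • fderiv ℝ (extZero Ω f) p _
        rw [fderiv_extZero_congr Ω (g := c • extZero Ω f)
          (fun y hy => by simp [extZero_apply_mem Ω _ hy]),
          fderiv_const_smul (differentiableAt_extZero Ω f p)]
        rfl }
    (fun f g => by
      ext p
      change fderiv ℝ (extZero Ω _) p _ =
        f.1 p * fderiv ℝ (extZero Ω g) p _ + g.1 p * fderiv ℝ (extZero Ω f) p _
      rw [fderiv_extZero_congr Ω (g := extZero Ω f * extZero Ω g)
        (fun y hy => by simp [extZero_apply_mem Ω _ hy]),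
        fderiv_mul (differentiableAt_extZero Ω f p) (differentiableAt_extZero Ω g p)]
      simp [extZero_apply])

end Smooth

/-! ### Formal pseudo-differential operators

Formal pseudo-differential operators in `D = ∂/∂x`, polynomial in `∂/∂τ` and `∂/∂t`, are realised
faithfully as operators on formal oscillating functions
`(∑_{n ≤ m} b_n(y, s) z^n) e^{xz + τy + ts}` with `b_n ∈ 𝓐[y, s]`. Here `D` acts on the amplitude
as `∂_x + z`, which is invertible, `∂/∂τ` as `∂_τ + y`, `∂/∂t` as `∂_t + s`, and the product is
composition. An operator `∑ a_{n,i,j} D^n ∂_τ^i ∂_t^j` maps the amplitude `1` to its full symbol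
`∑ a_{n,i,j} z^n y^i s^j`, so equality of operators is equality of all coefficients. -/

section PDO

variable (𝓐 : Type*) [CommRing 𝓐] [Algebra ℂ 𝓐]

/-- Amplitudes: `f n (i, j)` is the coefficient of `z^n y^i s^j`; `f n = 0` for large `n`. -/
def ampSubmodule : Submodule 𝓐 (ℤ → (ℕ × ℕ →₀ 𝓐)) where
  carrier := {f | ∃ m : ℤ, ∀ n, m < n → f n = 0}
  add_mem' := by
    rintro f g ⟨m, hm⟩ ⟨m', hm'⟩
    refine ⟨max m m', fun n hn => ?_⟩
    simp [hm n (lt_of_le_of_lt (le_max_left _ _) hn),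
      hm' n (lt_of_le_of_lt (le_max_right _ _) hn)]
  zero_mem' := ⟨0, fun _ _ => rfl⟩
  smul_mem' := by
    rintro a f ⟨m, hm⟩
    exact ⟨m, fun n hn => by simp [hm n hn]⟩

/-- The space of amplitudes. -/
def Amp : Type _ := ampSubmodule 𝓐

instance : AddCommGroup (Amp 𝓐) := inferInstanceAs (AddCommGroup (ampSubmodule 𝓐))

instance : Module 𝓐 (Amp 𝓐) := inferInstanceAs (Module 𝓐 (ampSubmodule 𝓐))

instance : Module ℂ (Amp 𝓐) := inferInstanceAs (Module ℂ (ampSubmodule 𝓐))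

instance : IsScalarTower ℂ 𝓐 (Amp 𝓐) := inferInstanceAs (IsScalarTower ℂ 𝓐 (ampSubmodule 𝓐))

/-- The ring that contains the scalar formal pseudo-differential operators. -/
abbrev PDO : Type _ := Module.End ℂ (Amp 𝓐)

variable {𝓐}

/-- The coefficient of `z^n`. -/
def Amp.coeff (f : Amp 𝓐) : ℤ → (ℕ × ℕ →₀ 𝓐) := Subtype.val f

/-- The amplitude with given coefficients. -/
def Amp.mk (g : ℤ → (ℕ × ℕ →₀ 𝓐)) (hg : ∃ m : ℤ, ∀ n, m < n → g n = 0) : Amp 𝓐 := ⟨g, hg⟩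

theorem Amp.bounded (f : Amp 𝓐) : ∃ m : ℤ, ∀ n, m < n → f.coeff n = 0 := Subtype.property f

theorem Amp.ext_coeff {f g : Amp 𝓐} (h : ∀ n, f.coeff n = g.coeff n) : f = g :=
  Subtype.ext (funext h)

/-- The operator of multiplication by a function. -/
def PDO.fn : 𝓐 →ₐ[ℂ] PDO 𝓐 := Algebra.lsmul ℂ ℂ (Amp 𝓐)

/-- Apply a linear map to every coefficient of `z^n`. -/
def PDO.coeffwise (g : (ℕ × ℕ →₀ 𝓐) →ₗ[ℂ] (ℕ × ℕ →₀ 𝓐)) : PDO 𝓐 where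
  toFun f := Amp.mk (fun n => g (f.coeff n)) <| by
    obtain ⟨m, hm⟩ := f.bounded
    exact ⟨m, fun n hn => by simp [hm n hn]⟩
  map_add' f h := Amp.ext_coeff fun n => map_add g (f.coeff n) (h.coeff n)
  map_smul' c f := Amp.ext_coeff fun n => map_smul g c (f.coeff n)

/-- Multiplication by `z`. -/
def PDO.mulZ : PDO 𝓐 where
  toFun f := Amp.mk (fun n => f.coeff (n - 1)) <| by
    obtain ⟨m, hm⟩ := f.bounded
    exact ⟨m + 1, fun n hn => hm _ (by omega)⟩
  map_add' f h := rfl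
  map_smul' c f := rfl

/-- `D = ∂_x + z`. -/
def PDO.D (d : Derivation ℂ 𝓐 𝓐) : PDO 𝓐 :=
  PDO.coeffwise (Finsupp.mapRange.linearMap d.toLinearMap) + PDO.mulZ

/-- `∂/∂τ = ∂_τ + y`. -/
def PDO.Dτ (d : Derivation ℂ 𝓐 𝓐) : PDO 𝓐 :=
  PDO.coeffwise (Finsupp.mapRange.linearMap d.toLinearMap +
    Finsupp.lmapDomain 𝓐 ℂ fun p => (p.1 + 1, p.2))

/-- `∂/∂t = ∂_t + s`. -/
def PDO.Dt (d : Derivation ℂ 𝓐 𝓐) : PDO 𝓐 :=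
  PDO.coeffwise (Finsupp.mapRange.linearMap d.toLinearMap +
    Finsupp.lmapDomain 𝓐 ℂ fun p => (p.1, p.2 + 1))

theorem PDO.coeff_D (d : Derivation ℂ 𝓐 𝓐) (f : Amp 𝓐) (n : ℤ) :
    (PDO.D d f).coeff n =
      Finsupp.mapRange.linearMap d.toLinearMap (f.coeff n) + f.coeff (n - 1) := rfl

theorem PDO.D_bijective (d : Derivation ℂ 𝓐 𝓐) : Function.Bijective (PDO.D d) := by
  constructor
  · rw [injective_iff_map_eq_zero]
    intro f hf
    obtain ⟨m, hm⟩ := f.bounded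
    have key : ∀ j : ℕ, f.coeff (m + 1 - j) = 0 := by
      intro j
      induction j with
      | zero => exact hm _ (by simp)
      | succ j ih =>
        have h : (PDO.D d f).coeff (m + 1 - j) = 0 := by rw [hf]; rfl
        rw [PDO.coeff_D, ih, map_zero, zero_add] at h
        have e : m + 1 - ((j + 1 : ℕ) : ℤ) = m + 1 - (j : ℤ) - 1 := by push_cast; omega
        rw [e, h]
    refine Amp.ext_coeff fun n => ?_
    change f.coeff n = 0
    rcases lt_or_ge m n with h | h
    · exact hm n h
    · have := key (m + 1 - n).toNat
      rw [Int.toNat_of_nonneg (by omega), sub_sub_cancel] at this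
      exact this
  · intro f
    obtain ⟨m, hm⟩ := f.bounded
    let h : ℕ → (ℕ × ℕ →₀ 𝓐) := fun j => Nat.rec 0
      (fun j b => f.coeff (m - j) - Finsupp.mapRange.linearMap d.toLinearMap b) j
    refine ⟨Amp.mk (fun n => h (m - n).toNat) ⟨m, fun n hn => ?_⟩, Amp.ext_coeff fun n => ?_⟩
    · have : (m - n).toNat = 0 := by omega
      rw [this]
      rfl
    · rw [PDO.coeff_D]
      change Finsupp.mapRange.linearMap d.toLinearMap (h (m - n).toNat)
        + h (m - (n - 1)).toNat = f.coeff n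
      rcases lt_or_ge m n with hn | hn
      · have h1 : (m - n).toNat = 0 := by omega
        have h2 : (m - (n - 1)).toNat = 0 := by omega
        rw [h1, h2, hm n hn]
        change Finsupp.mapRange.linearMap d.toLinearMap 0 + 0 = 0
        rw [map_zero, add_zero]
      · have h2 : (m - (n - 1)).toNat = (m - n).toNat + 1 := by omega
        have h3 : h ((m - n).toNat + 1) = f.coeff (m - ((m - n).toNat : ℕ)) -
          Finsupp.mapRange.linearMap d.toLinearMap (h (m - n).toNat) := rfl
        rw [h2, h3, Int.toNat_of_nonneg (by omega), sub_sub_cancel, add_sub_cancel]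

/-- The formal inverse `D^{-1}` of `D`. -/
def PDO.Dinv (d : Derivation ℂ 𝓐 𝓐) : PDO 𝓐 :=
  (LinearEquiv.ofBijective (PDO.D d) (PDO.D_bijective d)).symm.toLinearMap

end PDO

/-! ### Matrix integro-differential operators and their action on functions -/

section IntDiff

variable (𝓐 : Type*) [CommRing 𝓐] [Algebra ℂ 𝓐]

/-- The three derivatives of functions, and the integration `f ↦ D^{-1}{f}` of functions. -/
structure Calculus where
  dx : Derivation ℂ 𝓐 𝓐
  dτ : Derivation ℂ 𝓐 𝓐
  dt : Derivation ℂ 𝓐 𝓐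
  int : 𝓐 →ₗ[ℂ] 𝓐

/-- An `N × N` integro-differential operator `A` is recorded by its formal pseudo-differential
operator, its action `h ↦ A{h}` on columns of functions, and the action `h ↦ A^τ{h}` of its formal
transpose; sums and products are those of operators (the transpose reverses products). All operators
used below are built, by sums, products and scalars, from the generators `mulFn`, `Dx`, `Dτ`, `Dt`, `intOp`. -/
def IntDiffOp (N : ℕ) : Type _ :=
  Matrix (Fin N) (Fin N) (PDO 𝓐) × Module.End ℂ (Fin N → 𝓐) × (Module.End ℂ (Fin N → 𝓐))ᵐᵒᵖ

instance (N : ℕ) : Ring (IntDiffOp 𝓐 N) :=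
  inferInstanceAs (Ring (Matrix (Fin N) (Fin N) (PDO 𝓐) ×
    Module.End ℂ (Fin N → 𝓐) × (Module.End ℂ (Fin N → 𝓐))ᵐᵒᵖ))

instance (N : ℕ) : Module ℂ (IntDiffOp 𝓐 N) :=
  inferInstanceAs (Module ℂ (Matrix (Fin N) (Fin N) (PDO 𝓐) ×
    Module.End ℂ (Fin N → 𝓐) × (Module.End ℂ (Fin N → 𝓐))ᵐᵒᵖ))

variable {𝓐} {N : ℕ}

/-- The formal pseudo-differential operator. -/
def IntDiffOp.formal (A : IntDiffOp 𝓐 N) : Matrix (Fin N) (Fin N) (PDO 𝓐) := A.1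

/-- `A{h}` for a matrix function `h` (column by column). -/
def IntDiffOp.act (A : IntDiffOp 𝓐 N) {K : ℕ} (h : Matrix (Fin N) (Fin K) 𝓐) :
    Matrix (Fin N) (Fin K) 𝓐 := Matrix.of fun i k => A.2.1 (fun i' => h i' k) i

/-- `A^τ{h}` for a matrix function `h` (column by column). -/
def IntDiffOp.actT (A : IntDiffOp 𝓐 N) {K : ℕ} (h : Matrix (Fin N) (Fin K) 𝓐) :
    Matrix (Fin N) (Fin K) 𝓐 := Matrix.of fun i k => A.2.2.unop (fun i' => h i' k) i

/-- Apply a linear map to each entry of a column. -/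
def entrywise (g : 𝓐 →ₗ[ℂ] 𝓐) {m : ℕ} : (Fin m → 𝓐) →ₗ[ℂ] (Fin m → 𝓐) := g.compLeft (Fin m)

/-- A rectangular matrix of functions acting on columns of functions. -/
def mulCol {m p : ℕ} (f : Matrix (Fin m) (Fin p) 𝓐) : (Fin p → 𝓐) →ₗ[ℂ] (Fin m → 𝓐) :=
  f.mulVecLin.restrictScalars ℂ

/-- A constant matrix viewed as a matrix function. -/
def const (𝓐 : Type*) [CommRing 𝓐] [Algebra ℂ 𝓐] {m p : ℕ}
    (X : Matrix (Fin m) (Fin p) ℂ) : Matrix (Fin m) (Fin p) 𝓐 := X.map (algebraMap ℂ 𝓐)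

/-- Multiplication by a matrix function `u`; the transpose is multiplication by `uᵀ`. -/
def mulFn (u : Matrix (Fin N) (Fin N) 𝓐) : IntDiffOp 𝓐 N :=
  (u.map PDO.fn, mulCol u, MulOpposite.op (mulCol u.transpose))

namespace Calculus

variable (𝒞 : Calculus 𝓐)

/-- `D = ∂/∂x`, with `D^τ = -D`. -/
def Dx : IntDiffOp 𝓐 N :=
  (Matrix.scalar (Fin N) (PDO.D 𝒞.dx), entrywise 𝒞.dx.toLinearMap,
    MulOpposite.op (-entrywise 𝒞.dx.toLinearMap))

/-- `∂/∂τ`, with transpose `-∂/∂τ`. -/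
def Dτ : IntDiffOp 𝓐 N :=
  (Matrix.scalar (Fin N) (PDO.Dτ 𝒞.dτ), entrywise 𝒞.dτ.toLinearMap,
    MulOpposite.op (-entrywise 𝒞.dτ.toLinearMap))

/-- `∂/∂t`, with transpose `-∂/∂t`. -/
def Dt : IntDiffOp 𝓐 N :=
  (Matrix.scalar (Fin N) (PDO.Dt 𝒞.dt), entrywise 𝒞.dt.toLinearMap,
    MulOpposite.op (-entrywise 𝒞.dt.toLinearMap))

/-- The operator `f D^{-1} gᵀ`, for `N × m` matrix functions `f` and `g`. It acts as
`h ↦ f D^{-1}{gᵀ h}`, and its transpose `-g D^{-1} fᵀ` as `h ↦ -g D^{-1}{fᵀ h}`. -/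
def intOp {m : ℕ} (f g : Matrix (Fin N) (Fin m) 𝓐) : IntDiffOp 𝓐 N :=
  (f.map PDO.fn * Matrix.scalar (Fin m) (PDO.Dinv 𝒞.dx) * g.transpose.map PDO.fn,
    mulCol f ∘ₗ entrywise 𝒞.int ∘ₗ mulCol g.transpose,
    MulOpposite.op (-(mulCol g ∘ₗ entrywise 𝒞.int ∘ₗ mulCol f.transpose)))

/-- The differential operator `∑_{j=0}^{k} u_j D^j`. -/
def diffOp {k : ℕ} (u : Fin (k + 1) → Matrix (Fin N) (Fin N) 𝓐) : IntDiffOp 𝓐 N :=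
  ∑ j, mulFn (u j) * 𝒞.Dx ^ (j : ℕ)

/-- `L_k = β ∂_τ - ∑_{j ≤ k} u_j D^j - q 𝓜₀ D^{-1} rᵀ`. -/
def opL {k m : ℕ} (β : ℂ) (u : Fin (k + 1) → Matrix (Fin N) (Fin N) 𝓐)
    (q r : Matrix (Fin N) (Fin m) 𝓐) (M₀ : Matrix (Fin m) (Fin m) ℂ) : IntDiffOp 𝓐 N :=
  β • (𝒞.Dτ : IntDiffOp 𝓐 N) - 𝒞.diffOp u - 𝒞.intOp (q * const 𝓐 M₀) r

/-- `∑_{j=0}^{l} f[j] X D^{-1} gᵀ[l-j]`, where `f[j] = L^j{f}` and `g[j] = (L^τ)^j{g}`. -/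
def bilinSum {m : ℕ} (L : IntDiffOp 𝓐 N) (l : ℕ) (f g : Matrix (Fin N) (Fin m) 𝓐)
    (X : Matrix (Fin m) (Fin m) ℂ) : IntDiffOp 𝓐 N :=
  ∑ j ∈ Finset.range (l + 1),
    𝒞.intOp ((L ^ j).act f * const 𝓐 X) ((L ^ (l - j)).actT g)

/-- `M_{n,l} = α ∂_t - ∑_{i ≤ n} v_i D^i - c ∑_{j=0}^{l} q[j] 𝓜₀ D^{-1} rᵀ[l-j]`, with
`q[j] = L^j{q}` and `r[j] = (L^τ)^j{r}`. -/
def opM {n m : ℕ} (L : IntDiffOp 𝓐 N) (l : ℕ) (α c : ℂ)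
    (v : Fin (n + 1) → Matrix (Fin N) (Fin N) 𝓐)
    (q r : Matrix (Fin N) (Fin m) 𝓐) (M₀ : Matrix (Fin m) (Fin m) ℂ) : IntDiffOp 𝓐 N :=
  α • (𝒞.Dt : IntDiffOp 𝓐 N) - 𝒞.diffOp v - c • 𝒞.bilinSum L l q r M₀

variable {K : ℕ} (C : Matrix (Fin K) (Fin K) ℂ) (φ ψ : Matrix (Fin N) (Fin K) 𝓐)

/-- `Δ = C + D^{-1}{ψᵀ φ}`. -/
def Delta : Matrix (Fin K) (Fin K) 𝓐 := const 𝓐 C + (ψ.transpose * φ).map 𝒞.int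

/-- `Φ = φ Δ^{-1}`. -/
def Phi : Matrix (Fin N) (Fin K) 𝓐 := φ * (𝒞.Delta C φ ψ)⁻¹

/-- `Ψ = ψ (Δ^{-1})ᵀ`. -/
def Psi : Matrix (Fin N) (Fin K) 𝓐 := ψ * ((𝒞.Delta C φ ψ)⁻¹).transpose

/-- `W = I - φ Δ^{-1} D^{-1} ψᵀ`. -/
def W : IntDiffOp 𝓐 N := 1 - 𝒞.intOp (φ * (𝒞.Delta C φ ψ)⁻¹) ψ

/-- `W^{-1} = I + φ D^{-1} Δ^{-1} ψᵀ`. -/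
def Winv : IntDiffOp 𝓐 N := 1 + 𝒞.intOp φ (ψ * ((𝒞.Delta C φ ψ)⁻¹).transpose)

end Calculus

end IntDiff

/-! ### Realisations of the integration `D^{-1}{f}` -/

section Realisation

variable (Ω : TopologicalSpace.Opens (Fin 3 → ℝ))

/-- A realisation of the integration `f ↦ D^{-1}{f}` of functions of `(x, τ, t) ∈ Ω`, with the
function classes on which the integro-differential operators act: an algebra `coeff` of coefficients,
an ideal `integrable` of it on which `int` is the two-sided inverse of `D = ∂/∂x`, and `coeff`-modules
`right`, `left` whose products `g f` (`g ∈ left`, `f ∈ right`) can be integrated. All are stable under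
partial differentiation. For instance, `integrable = left = right` may consist of the functions which
vanish exponentially with all derivatives as `x → -∞`, with `D^{-1}{f} = ∫_{-∞}^x f`. -/
structure Realisation where
  coeff : Subalgebra ℂ (smoothFns Ω)
  integrable : Submodule ℂ (smoothFns Ω)
  right : Submodule ℂ (smoothFns Ω)
  left : Submodule ℂ (smoothFns Ω)
  int : smoothFns Ω →ₗ[ℂ] smoothFns Ω
  integrable_le : ∀ f ∈ integrable, f ∈ coeff
  mul_integrable : ∀ a ∈ coeff, ∀ f ∈ integrable, a * f ∈ integrable
  mul_right : ∀ a ∈ coeff, ∀ f ∈ right, a * f ∈ right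
  mul_left : ∀ a ∈ coeff, ∀ f ∈ left, a * f ∈ left
  left_mul_right : ∀ g ∈ left, ∀ f ∈ right, g * f ∈ integrable
  pderiv_coeff : ∀ i, ∀ f ∈ coeff, pderiv Ω i f ∈ coeff
  pderiv_integrable : ∀ i, ∀ f ∈ integrable, pderiv Ω i f ∈ integrable
  pderiv_right : ∀ i, ∀ f ∈ right, pderiv Ω i f ∈ right
  pderiv_left : ∀ i, ∀ f ∈ left, pderiv Ω i f ∈ left
  int_mem : ∀ f ∈ integrable, int f ∈ integrable
  pderiv_int : ∀ f ∈ integrable, pderiv Ω 0 (int f) = f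
  int_pderiv : ∀ f ∈ integrable, int (pderiv Ω 0 f) = f

/-- The calculus of smooth functions with coordinates `x = p 0`, `τ = p 1`, `t = p 2`. -/
def Realisation.calculus {Ω : TopologicalSpace.Opens (Fin 3 → ℝ)} (ρ : Realisation Ω) :
    Calculus (smoothFns Ω) where
  dx := pderiv Ω 0
  dτ := pderiv Ω 1
  dt := pderiv Ω 2
  int := ρ.int

end Realisation

end BDT

end

/-! Conjugation by $W$ produces, besides the expected dressed operator, two integral terms governed
by the action of $A$ on $\varphi$ and of $A^\tau$ on $\psi$. The linear map `dressedPart` subtracts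
these terms, namely $W\{A\{\varphi\}\}D^{-1}\Psi^\top-\Phi
D^{-1}((W^{-1})^\tau\{A^\tau\{\psi\}\})^\top$, from $WAW^{-1}$. Being linear in $A$, it can be
evaluated on each kind of summand of $L$ and $M$ separately: $uD^j$ gives a differential operator of
order at most $j$ (`dressedPart_mulFn_mul_Dx_pow`), $fD^{-1}g^\top$ gives
$W\{f\}D^{-1}((W^{-1})^\tau\{g\})^\top$ (`dressedPart_intOp`), and $\partial_\tau,\partial_t$ are
unchanged (`dressedPart_evolution`). All three rest on
$D^{-1}fD^{-1}=D^{-1}\{f\}D^{-1}-D^{-1}D^{-1}\{f\}$ and on integration by parts.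

The eigenvalue equations come in only afterwards. Since $W\{\varphi\}=\Phi C$ and
$(W^{-1})^\tau\{\psi\}=\Psi C^\top$, the subtracted terms collapse to $\Phi(CX-Y^\top
C)D^{-1}\Psi^\top$ when $A\{\varphi\}=\varphi X$ and $A^\tau\{\psi\}=\psi Y$
(`formal_dressed_of_eigen`).

For $L$ this is already the claim. For $M$ the middle matrix is
$c(C\Lambda^{l+1}-(\tilde\Lambda^{l+1})^\top C)$, and it must be spread over the sum of
$\Phi[s]\mathcal M_1D^{-1}\Psi[l-s]^\top$. As $\Phi$ and $\Psi$ are eigenfunctions of $\hat L$ and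
$\hat L^\tau$ with constant matrices conjugate to $\Lambda$ and $\tilde\Lambda$, that sum telescopes
(`formal_bilinSum_Phi_Psi`). Evaluating $\hat L^j$ on dressed functions also needs
$W^{-1}\{W\{f\}\}=f$ for functions, which is separate from the formal identity $W^{-1}W=1$
(`act_Winv_act_W`, `actT_W_actT_Winv`). -/

noncomputable section

namespace BDT

/-! ### Commutation rules for matrices of formal pseudo-differential operators -/

section FormalAlgebra

variable {𝓐 : Type*} [CommRing 𝓐] [Algebra ℂ 𝓐]

/-- An operator `T` obeys the Leibniz rule with respect to a derivation `δ` of functions. -/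
def PDO.IsLeibniz (T : PDO 𝓐) (δ : Derivation ℂ 𝓐 𝓐) : Prop :=
  ∀ a, T * PDO.fn a = PDO.fn a * T + PDO.fn (δ a)

omit [Algebra ℂ 𝓐] in
theorem Amp.coeff_add (f g : Amp 𝓐) (n : ℤ) : (f + g).coeff n = f.coeff n + g.coeff n := rfl

theorem PDO.coeff_fn (a : 𝓐) (f : Amp 𝓐) (n : ℤ) : (PDO.fn a f).coeff n = a • f.coeff n := rfl

theorem mapRange_derivation_smul (d : Derivation ℂ 𝓐 𝓐) (a : 𝓐) (f : ℕ × ℕ →₀ 𝓐) :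
    Finsupp.mapRange.linearMap d.toLinearMap (a • f) =
      a • Finsupp.mapRange.linearMap d.toLinearMap f + d a • f := by
  ext i
  simp [mul_comm]

theorem PDO.D_isLeibniz (d : Derivation ℂ 𝓐 𝓐) : (PDO.D d).IsLeibniz d := by
  intro a
  refine LinearMap.ext fun f => Amp.ext_coeff fun n => ?_
  simp only [Module.End.mul_apply, LinearMap.add_apply, Amp.coeff_add, PDO.coeff_fn, PDO.coeff_D,
    mapRange_derivation_smul, smul_add]
  abel

/-- A derivation of the coefficients plus a shift of monomials obeys the Leibniz rule. -/
theorem PDO.coeffwise_isLeibniz (δ : Derivation ℂ 𝓐 𝓐) (s : ℕ × ℕ → ℕ × ℕ) :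
    (PDO.coeffwise (Finsupp.mapRange.linearMap δ.toLinearMap +
      Finsupp.lmapDomain 𝓐 ℂ s)).IsLeibniz δ := by
  intro a
  refine LinearMap.ext fun f => Amp.ext_coeff fun n => ?_
  change Finsupp.mapRange.linearMap δ.toLinearMap (a • f.coeff n) +
      Finsupp.mapDomain s (a • f.coeff n) =
    a • (Finsupp.mapRange.linearMap δ.toLinearMap (f.coeff n) +
      Finsupp.mapDomain s (f.coeff n)) + δ a • f.coeff n
  rw [mapRange_derivation_smul, Finsupp.mapDomain_smul, smul_add]
  abel

/-- Multiplication by $z$ only moves coefficients and so commutes with anything acting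
coefficientwise. What remains is that $d$ commutes with $\delta$ by hypothesis, and with the
relabelling of monomials because it acts on their coefficients. -/
theorem PDO.coeffwise_commute_D (d δ : Derivation ℂ 𝓐 𝓐) (h : ∀ a, δ (d a) = d (δ a))
    (s : ℕ × ℕ → ℕ × ℕ) :
    Commute (PDO.coeffwise (Finsupp.mapRange.linearMap δ.toLinearMap +
      Finsupp.lmapDomain 𝓐 ℂ s)) (PDO.D d) := by
  set g : (ℕ × ℕ →₀ 𝓐) →ₗ[ℂ] (ℕ × ℕ →₀ 𝓐) :=
    Finsupp.mapRange.linearMap δ.toLinearMap + Finsupp.lmapDomain 𝓐 ℂ s with hg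
  refine LinearMap.ext fun f => Amp.ext_coeff fun n => ?_
  change g (Finsupp.mapRange.linearMap d.toLinearMap (f.coeff n) + f.coeff (n - 1)) =
    Finsupp.mapRange.linearMap d.toLinearMap (g (f.coeff n)) + g (f.coeff (n - 1))
  rw [map_add, add_left_inj, hg, LinearMap.add_apply, LinearMap.add_apply, map_add]
  congr 1
  · ext i
    simp [h]
  · exact Finsupp.mapDomain_mapRange s (f.coeff n) d (map_zero d) (map_add d)

theorem PDO.D_mul_Dinv (d : Derivation ℂ 𝓐 𝓐) : PDO.D d * PDO.Dinv d = 1 :=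
  LinearMap.ext fun f =>
    (LinearEquiv.ofBijective (PDO.D d) (PDO.D_bijective d)).apply_symm_apply f

theorem PDO.Dinv_mul_D (d : Derivation ℂ 𝓐 𝓐) : PDO.Dinv d * PDO.D d = 1 :=
  LinearMap.ext fun f =>
    (LinearEquiv.ofBijective (PDO.D d) (PDO.D_bijective d)).symm_apply_apply f

theorem PDO.commute_Dinv {d : Derivation ℂ 𝓐 𝓐} {T : PDO 𝓐} (h : Commute T (PDO.D d)) :
    Commute T (PDO.Dinv d) := by
  calc T * PDO.Dinv d = PDO.Dinv d * PDO.D d * T * PDO.Dinv d := by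
        rw [PDO.Dinv_mul_D, one_mul]
    _ = PDO.Dinv d * (T * PDO.D d) * PDO.Dinv d := by rw [h.eq]; simp only [mul_assoc]
    _ = PDO.Dinv d * T := by simp only [mul_assoc, PDO.D_mul_Dinv, mul_one]

/-- A matrix function as a matrix of multiplication operators. -/
def fnMat {m n : ℕ} (f : Matrix (Fin m) (Fin n) 𝓐) : Matrix (Fin m) (Fin n) (PDO 𝓐) :=
  f.map PDO.fn

/-- `T I_n` for a scalar operator `T`. -/
def scalarMat (n : ℕ) (T : PDO 𝓐) : Matrix (Fin n) (Fin n) (PDO 𝓐) := Matrix.scalar (Fin n) T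

variable {m n p : ℕ}

theorem fnMat_mul (f : Matrix (Fin m) (Fin n) 𝓐) (g : Matrix (Fin n) (Fin p) 𝓐) :
    fnMat (f * g) = fnMat f * fnMat g := Matrix.map_mul

theorem fnMat_add (f g : Matrix (Fin m) (Fin n) 𝓐) : fnMat (f + g) = fnMat f + fnMat g :=
  Matrix.map_add _ (map_add PDO.fn) f g

theorem fnMat_sub (f g : Matrix (Fin m) (Fin n) 𝓐) : fnMat (f - g) = fnMat f - fnMat g :=
  Matrix.map_sub _ (map_sub PDO.fn) f g

theorem fnMat_neg (f : Matrix (Fin m) (Fin n) 𝓐) : fnMat (-f) = -fnMat f := by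
  ext1 i j; exact map_neg PDO.fn _

theorem fnMat_smul (c : ℂ) (f : Matrix (Fin m) (Fin n) 𝓐) : fnMat (c • f) = c • fnMat f := by
  ext1 i j; exact map_smul PDO.fn c _

theorem fnMat_zero : fnMat (0 : Matrix (Fin m) (Fin n) 𝓐) = 0 := by
  ext1 i j; exact map_zero PDO.fn

theorem scalarMat_mul_fnMat {T : PDO 𝓐} {δ : Derivation ℂ 𝓐 𝓐} (hT : T.IsLeibniz δ)
    (f : Matrix (Fin m) (Fin n) 𝓐) :
    scalarMat m T * fnMat f = fnMat f * scalarMat n T + fnMat (f.map δ) := by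
  ext1 i j
  simp only [scalarMat, fnMat, Matrix.scalar_apply, Matrix.diagonal_mul, Matrix.mul_diagonal,
    Matrix.add_apply, Matrix.map_apply]
  exact hT _

theorem scalarMat_mul_scalarMat (S T : PDO 𝓐) :
    scalarMat n S * scalarMat n T = scalarMat n (S * T) := (map_mul (Matrix.scalar (Fin n)) S T).symm

variable (d : Derivation ℂ 𝓐 𝓐)

theorem D_mul_Dinv_scalarMat : scalarMat n (PDO.D d) * scalarMat n (PDO.Dinv d) = 1 := by
  rw [scalarMat_mul_scalarMat, PDO.D_mul_Dinv]
  exact map_one _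

theorem Dinv_mul_D_scalarMat : scalarMat n (PDO.Dinv d) * scalarMat n (PDO.D d) = 1 := by
  rw [scalarMat_mul_scalarMat, PDO.Dinv_mul_D]
  exact map_one _

/-- `D^{-1} f' D^{-1} = f D^{-1} - D^{-1} f`. -/
theorem Dinv_fnMat_Dinv (f : Matrix (Fin m) (Fin n) 𝓐) :
    scalarMat m (PDO.Dinv d) * fnMat (f.map d) * scalarMat n (PDO.Dinv d) =
      fnMat f * scalarMat n (PDO.Dinv d) - scalarMat m (PDO.Dinv d) * fnMat f := by
  have h := scalarMat_mul_fnMat (PDO.D_isLeibniz d) f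
  rw [eq_sub_of_add_eq' h.symm, Matrix.mul_sub, ← Matrix.mul_assoc, Dinv_mul_D_scalarMat,
    Matrix.one_mul, Matrix.sub_mul]
  congr 1
  rw [Matrix.mul_assoc, Matrix.mul_assoc, D_mul_Dinv_scalarMat, Matrix.mul_one]

/-- `D^{-1} f D = f - D^{-1} f'`. -/
theorem Dinv_fnMat_D (f : Matrix (Fin m) (Fin n) 𝓐) :
    scalarMat m (PDO.Dinv d) * fnMat f * scalarMat n (PDO.D d) =
      fnMat f - scalarMat m (PDO.Dinv d) * fnMat (f.map d) := by
  have h := scalarMat_mul_fnMat (PDO.D_isLeibniz d) f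
  rw [Matrix.mul_assoc, eq_sub_of_add_eq h.symm, Matrix.mul_sub, ← Matrix.mul_assoc,
    Dinv_mul_D_scalarMat, Matrix.one_mul]

/-- Matrix differential operators of order at most `k`. -/
def diffOps (m n k : ℕ) : AddSubgroup (Matrix (Fin m) (Fin n) (PDO 𝓐)) :=
  AddSubgroup.closure {X | ∃ j ≤ k, ∃ w : Matrix (Fin m) (Fin n) 𝓐,
    X = fnMat w * scalarMat n (PDO.D d) ^ j}

variable {d}

theorem fnMat_mul_D_pow_mem_diffOps {j k : ℕ} (h : j ≤ k) (w : Matrix (Fin m) (Fin n) 𝓐) :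
    fnMat w * scalarMat n (PDO.D d) ^ j ∈ diffOps d m n k :=
  AddSubgroup.subset_closure ⟨j, h, w, rfl⟩

theorem fnMat_mem_diffOps (k : ℕ) (w : Matrix (Fin m) (Fin n) 𝓐) :
    fnMat w ∈ diffOps d m n k := by
  simpa using fnMat_mul_D_pow_mem_diffOps (d := d) (Nat.zero_le k) w

theorem diffOps_mono {j k : ℕ} (h : j ≤ k) : diffOps d m n j ≤ diffOps d m n k :=
  AddSubgroup.closure_mono fun _ ⟨i, hi, w, hw⟩ => ⟨i, hi.trans h, w, hw⟩

theorem fnMat_mul_mem_diffOps {k : ℕ} {X : Matrix (Fin n) (Fin p) (PDO 𝓐)}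
    (hX : X ∈ diffOps d n p k) (f : Matrix (Fin m) (Fin n) 𝓐) :
    fnMat f * X ∈ diffOps d m p k := by
  induction hX using AddSubgroup.closure_induction with
  | mem X h =>
    obtain ⟨j, hj, w, rfl⟩ := h
    rw [← Matrix.mul_assoc, ← fnMat_mul]
    exact fnMat_mul_D_pow_mem_diffOps hj _
  | zero => rw [Matrix.mul_zero]; exact zero_mem _
  | add X Y _ _ hX hY => rw [Matrix.mul_add]; exact add_mem hX hY
  | neg X _ hX => rw [Matrix.mul_neg]; exact neg_mem hX

theorem D_mul_mem_diffOps {k : ℕ} {X : Matrix (Fin m) (Fin n) (PDO 𝓐)}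
    (hX : X ∈ diffOps d m n k) :
    scalarMat m (PDO.D d) * X ∈ diffOps d m n (k + 1) := by
  induction hX using AddSubgroup.closure_induction with
  | mem X h =>
    obtain ⟨j, hj, w, rfl⟩ := h
    rw [← Matrix.mul_assoc, scalarMat_mul_fnMat (PDO.D_isLeibniz d), Matrix.add_mul,
      Matrix.mul_assoc, ← pow_succ']
    exact add_mem (fnMat_mul_D_pow_mem_diffOps (by omega) _)
      (fnMat_mul_D_pow_mem_diffOps (by omega) _)
  | zero => rw [Matrix.mul_zero]; exact zero_mem _
  | add X Y _ _ hX hY => rw [Matrix.mul_add]; exact add_mem hX hY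
  | neg X _ hX => rw [Matrix.mul_neg]; exact neg_mem hX

theorem mul_D_mem_diffOps {k : ℕ} {X : Matrix (Fin m) (Fin n) (PDO 𝓐)}
    (hX : X ∈ diffOps d m n k) :
    X * scalarMat n (PDO.D d) ∈ diffOps d m n (k + 1) := by
  induction hX using AddSubgroup.closure_induction with
  | mem X h =>
    obtain ⟨j, hj, w, rfl⟩ := h
    rw [Matrix.mul_assoc, ← pow_succ]
    exact fnMat_mul_D_pow_mem_diffOps (by omega) _
  | zero => rw [Matrix.zero_mul]; exact zero_mem _
  | add X Y _ _ hX hY => rw [Matrix.add_mul]; exact add_mem hX hY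
  | neg X _ hX => rw [Matrix.neg_mul]; exact neg_mem hX

theorem D_pow_mul_fnMat_mem_diffOps (j : ℕ) (f : Matrix (Fin m) (Fin n) 𝓐) :
    scalarMat m (PDO.D d) ^ j * fnMat f ∈ diffOps d m n j := by
  induction j with
  | zero => rw [pow_zero, Matrix.one_mul]; exact fnMat_mem_diffOps _ _
  | succ j ih => rw [pow_succ', Matrix.mul_assoc]; exact D_mul_mem_diffOps ih

theorem mul_fnMat_mem_diffOps {k : ℕ} {X : Matrix (Fin m) (Fin n) (PDO 𝓐)}
    (hX : X ∈ diffOps d m n k) (f : Matrix (Fin n) (Fin p) 𝓐) :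
    X * fnMat f ∈ diffOps d m p k := by
  induction hX using AddSubgroup.closure_induction with
  | mem X h =>
    obtain ⟨j, hj, w, rfl⟩ := h
    rw [Matrix.mul_assoc]
    exact fnMat_mul_mem_diffOps (diffOps_mono hj (D_pow_mul_fnMat_mem_diffOps j f)) w
  | zero => rw [Matrix.zero_mul]; exact zero_mem _
  | add X Y _ _ hX hY => rw [Matrix.add_mul]; exact add_mem hX hY
  | neg X _ hX => rw [Matrix.neg_mul]; exact neg_mem hX

/-- Membership in the generated subgroup is convenient for closure arguments. This recovers explicit
coefficients, one per degree, with zeros in the degrees that do not occur. -/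
theorem exists_eq_sum_of_mem_diffOps {k : ℕ} {X : Matrix (Fin m) (Fin n) (PDO 𝓐)}
    (hX : X ∈ diffOps d m n k) :
    ∃ w : Fin (k + 1) → Matrix (Fin m) (Fin n) 𝓐,
      X = ∑ j, fnMat (w j) * scalarMat n (PDO.D d) ^ (j : ℕ) := by
  induction hX using AddSubgroup.closure_induction with
  | mem X h =>
    obtain ⟨j, hj, w, rfl⟩ := h
    refine ⟨Pi.single ⟨j, by omega⟩ w, ?_⟩
    rw [Finset.sum_eq_single ⟨j, by omega⟩]
    · simp
    · intro i _ hi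
      rw [Pi.single_eq_of_ne hi, fnMat_zero, Matrix.zero_mul]
    · simp
  | zero => exact ⟨0, by simp [fnMat_zero]⟩
  | add X Y _ _ hX hY =>
    obtain ⟨v, rfl⟩ := hX
    obtain ⟨w, rfl⟩ := hY
    exact ⟨v + w, by simp [fnMat_add, Matrix.add_mul, Finset.sum_add_distrib]⟩
  | neg X _ hX =>
    obtain ⟨v, rfl⟩ := hX
    exact ⟨-v, by simp [fnMat_neg]⟩

variable (d)

/-- `D^j f D^{-1} = f^{(j)} D^{-1} + (differential operator)`. -/
theorem D_pow_fnMat_Dinv (f : Matrix (Fin m) (Fin n) 𝓐) (j : ℕ) :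
    ∃ P ∈ diffOps d m n j, scalarMat m (PDO.D d) ^ j * fnMat f * scalarMat n (PDO.Dinv d) =
      fnMat ((fun h => h.map d)^[j] f) * scalarMat n (PDO.Dinv d) + P := by
  induction j with
  | zero => exact ⟨0, zero_mem _, by simp⟩
  | succ j ih =>
    obtain ⟨P, hP, h⟩ := ih
    refine ⟨fnMat ((fun h => h.map d)^[j] f) + scalarMat m (PDO.D d) * P,
      add_mem (fnMat_mem_diffOps _ _) (D_mul_mem_diffOps hP), ?_⟩
    rw [pow_succ', Matrix.mul_assoc, Matrix.mul_assoc, ← Matrix.mul_assoc (_ ^ j), h,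
      Matrix.mul_add, ← Matrix.mul_assoc, scalarMat_mul_fnMat (PDO.D_isLeibniz d),
      Matrix.add_mul, Matrix.mul_assoc, D_mul_Dinv_scalarMat, Matrix.mul_one,
      Function.iterate_succ_apply']
    abel

/-- `D^{-1} gᵀ D^j = D^{-1} ((-D)^j g)ᵀ + (differential operator)`. -/
theorem Dinv_fnMat_D_pow (g : Matrix (Fin n) (Fin m) 𝓐) (j : ℕ) :
    ∃ Q ∈ diffOps d m n j,
      scalarMat m (PDO.Dinv d) * fnMat g.transpose * scalarMat n (PDO.D d) ^ j =
        scalarMat m (PDO.Dinv d) * fnMat ((fun h => -h.map d)^[j] g).transpose + Q := by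
  induction j with
  | zero => exact ⟨0, zero_mem _, by simp⟩
  | succ j ih =>
    obtain ⟨Q, hQ, h⟩ := ih
    refine ⟨fnMat ((fun h => -h.map d)^[j] g).transpose + Q * scalarMat n (PDO.D d),
      add_mem (fnMat_mem_diffOps _ _) (mul_D_mem_diffOps hQ), ?_⟩
    rw [pow_succ, ← Matrix.mul_assoc, h, Matrix.add_mul, Dinv_fnMat_D,
      Function.iterate_succ_apply', Matrix.transpose_neg, fnMat_neg, Matrix.mul_neg,
      Matrix.transpose_map]
    abel

end FormalAlgebra

/-! ### Actions of integro-differential operators and of their transposes -/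

section Action

variable {𝓐 : Type*} [CommRing 𝓐] [Algebra ℂ 𝓐] {N m p : ℕ}

namespace IntDiffOp

variable (A B : IntDiffOp 𝓐 N) (f g : Matrix (Fin N) (Fin m) 𝓐) (c : ℂ)

theorem formal_mul : (A * B).formal = A.formal * B.formal := rfl
theorem formal_add : (A + B).formal = A.formal + B.formal := rfl
theorem formal_sub : (A - B).formal = A.formal - B.formal := rfl
theorem formal_smul : (c • A).formal = c • A.formal := rfl

theorem formal_pow (j : ℕ) : (A ^ j).formal = A.formal ^ j := by
  induction j with
  | zero => rfl
  | succ j ih => rw [pow_succ, pow_succ, formal_mul, ih]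

theorem formal_sum {ι : Type*} (s : Finset ι) (X : ι → IntDiffOp 𝓐 N) :
    (∑ i ∈ s, X i).formal = ∑ i ∈ s, (X i).formal :=
  map_sum (AddMonoidHom.mk' IntDiffOp.formal fun _ _ => rfl) X s

theorem act_mul : (A * B).act f = A.act (B.act f) := rfl
theorem act_one : (1 : IntDiffOp 𝓐 N).act f = f := rfl
theorem act_add_left : (A + B).act f = A.act f + B.act f := rfl
theorem act_smul_left : (c • A).act f = c • A.act f := rfl
theorem actT_mul : (A * B).actT f = B.actT (A.actT f) := rfl
theorem actT_one : (1 : IntDiffOp 𝓐 N).actT f = f := rfl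
theorem actT_add_left : (A + B).actT f = A.actT f + B.actT f := rfl
theorem actT_smul_left : (c • A).actT f = c • A.actT f := rfl

theorem act_add : A.act (f + g) = A.act f + A.act g := by
  ext i j
  exact congrFun (map_add A.2.1 (fun i' => f i' j) (fun i' => g i' j)) i

theorem act_smul : A.act (c • f) = c • A.act f := by
  ext i j
  exact congrFun (map_smul A.2.1 c (fun i' => f i' j)) i

theorem actT_add : A.actT (f + g) = A.actT f + A.actT g := by
  ext i j
  exact congrFun (map_add A.2.2.unop (fun i' => f i' j) (fun i' => g i' j)) i

theorem actT_smul : A.actT (c • f) = c • A.actT f := by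
  ext i j
  exact congrFun (map_smul A.2.2.unop c (fun i' => f i' j)) i

end IntDiffOp

/-- Columns of a product with a constant matrix are complex linear combinations of columns, so
complex linearity alone suffices. Hence every operator commutes with right multiplication by
constants. -/
theorem map_mul_const (T : (Fin N → 𝓐) →ₗ[ℂ] (Fin p → 𝓐)) {a : ℕ}
    (f : Matrix (Fin N) (Fin m) 𝓐) (X : Matrix (Fin m) (Fin a) ℂ) (i : Fin p) (k : Fin a) :
    T (fun i' => (f * const 𝓐 X) i' k) i = ∑ j, T (fun i' => f i' j) i * algebraMap ℂ 𝓐 (X j k) := by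
  have h : (fun i' => (f * const 𝓐 X) i' k) = ∑ j, X j k • fun i' => f i' j := by
    ext i'
    simp [Matrix.mul_apply, const, Algebra.smul_def, mul_comm]
  rw [h, map_sum, Finset.sum_apply]
  refine Finset.sum_congr rfl fun j _ => ?_
  rw [map_smul, Pi.smul_apply, Algebra.smul_def, mul_comm]

namespace IntDiffOp

variable (A : IntDiffOp 𝓐 N) (f : Matrix (Fin N) (Fin m) 𝓐)

theorem act_mul_const {a : ℕ} (X : Matrix (Fin m) (Fin a) ℂ) :
    A.act (f * const 𝓐 X) = A.act f * const 𝓐 X := by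
  ext i k
  rw [Matrix.mul_apply]
  exact map_mul_const A.2.1 f X i k

theorem actT_mul_const {a : ℕ} (X : Matrix (Fin m) (Fin a) ℂ) :
    A.actT (f * const 𝓐 X) = A.actT f * const 𝓐 X := by
  ext i k
  rw [Matrix.mul_apply]
  exact map_mul_const A.2.2.unop f X i k

theorem act_pow_of_eigen {X : Matrix (Fin m) (Fin m) ℂ} (h : A.act f = f * const 𝓐 X) (j : ℕ) :
    (A ^ j).act f = f * const 𝓐 (X ^ j) := by
  induction j with
  | zero => simp [act_one, const]
  | succ j ih =>
    rw [pow_succ, act_mul, h, act_mul_const, ih, Matrix.mul_assoc, pow_succ]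
    simp only [const, Matrix.map_mul]

theorem actT_pow_of_eigen {X : Matrix (Fin m) (Fin m) ℂ} (h : A.actT f = f * const 𝓐 X) (j : ℕ) :
    (A ^ j).actT f = f * const 𝓐 (X ^ j) := by
  induction j with
  | zero => simp [actT_one, const]
  | succ j ih =>
    -- Transposition reverses products, so the factor that acts first is split off on the left.
    rw [pow_succ', actT_mul, h, actT_mul_const, ih, Matrix.mul_assoc, pow_succ]
    simp only [const, Matrix.map_mul]

end IntDiffOp

theorem const_mul {a : ℕ} (X : Matrix (Fin m) (Fin p) ℂ) (Y : Matrix (Fin p) (Fin a) ℂ) :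
    const 𝓐 (X * Y) = const 𝓐 X * const 𝓐 Y := Matrix.map_mul

theorem const_one : const 𝓐 (1 : Matrix (Fin m) (Fin m) ℂ) = 1 :=
  Matrix.map_one _ (map_zero _) (map_one _)

theorem const_sub (X Y : Matrix (Fin m) (Fin p) ℂ) :
    const 𝓐 (X - Y) = const 𝓐 X - const 𝓐 Y := Matrix.map_sub _ (map_sub _) X Y

theorem const_transpose (X : Matrix (Fin m) (Fin p) ℂ) :
    const 𝓐 X.transpose = (const 𝓐 X).transpose := rfl

theorem formal_mulFn (u : Matrix (Fin N) (Fin N) 𝓐) : (mulFn u).formal = fnMat u := rfl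

theorem act_mulFn (u : Matrix (Fin N) (Fin N) 𝓐) (f : Matrix (Fin N) (Fin m) 𝓐) :
    (mulFn u).act f = u * f := rfl

theorem actT_mulFn (u : Matrix (Fin N) (Fin N) 𝓐) (f : Matrix (Fin N) (Fin m) 𝓐) :
    (mulFn u).actT f = u.transpose * f := rfl

namespace Calculus

variable (𝒞 : Calculus 𝓐) (f g : Matrix (Fin N) (Fin m) 𝓐) (h : Matrix (Fin N) (Fin p) 𝓐)

theorem formal_Dx : (𝒞.Dx : IntDiffOp 𝓐 N).formal = scalarMat N (PDO.D 𝒞.dx) := rfl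
theorem act_Dx : (𝒞.Dx : IntDiffOp 𝓐 N).act h = h.map 𝒞.dx := rfl
theorem actT_Dx : (𝒞.Dx : IntDiffOp 𝓐 N).actT h = -h.map 𝒞.dx := rfl
theorem formal_Dτ : (𝒞.Dτ : IntDiffOp 𝓐 N).formal = scalarMat N (PDO.Dτ 𝒞.dτ) := rfl
theorem act_Dτ : (𝒞.Dτ : IntDiffOp 𝓐 N).act h = h.map 𝒞.dτ := rfl
theorem actT_Dτ : (𝒞.Dτ : IntDiffOp 𝓐 N).actT h = -h.map 𝒞.dτ := rfl
theorem formal_Dt : (𝒞.Dt : IntDiffOp 𝓐 N).formal = scalarMat N (PDO.Dt 𝒞.dt) := rfl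
theorem act_Dt : (𝒞.Dt : IntDiffOp 𝓐 N).act h = h.map 𝒞.dt := rfl
theorem actT_Dt : (𝒞.Dt : IntDiffOp 𝓐 N).actT h = -h.map 𝒞.dt := rfl

theorem formal_intOp : (𝒞.intOp f g).formal =
    fnMat f * scalarMat m (PDO.Dinv 𝒞.dx) * fnMat g.transpose := rfl

theorem act_intOp : (𝒞.intOp f g).act h = f * (g.transpose * h).map 𝒞.int := rfl

theorem actT_intOp : (𝒞.intOp f g).actT h = -(g * (f.transpose * h).map 𝒞.int) := rfl

theorem act_Dx_pow (j : ℕ) :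
    ((𝒞.Dx : IntDiffOp 𝓐 N) ^ j).act h = (fun h => h.map 𝒞.dx)^[j] h := by
  induction j with
  | zero => rfl
  | succ j ih => rw [pow_succ', IntDiffOp.act_mul, ih, Function.iterate_succ_apply', act_Dx]

theorem actT_Dx_pow (j : ℕ) :
    ((𝒞.Dx : IntDiffOp 𝓐 N) ^ j).actT h = (fun h => -h.map 𝒞.dx)^[j] h := by
  induction j with
  | zero => rfl
  | succ j ih => rw [pow_succ, IntDiffOp.actT_mul, ih, Function.iterate_succ_apply', actT_Dx]

theorem formal_diffOp {k : ℕ} (u : Fin (k + 1) → Matrix (Fin N) (Fin N) 𝓐) :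
    (𝒞.diffOp u).formal = ∑ j, fnMat (u j) * scalarMat N (PDO.D 𝒞.dx) ^ (j : ℕ) := by
  simp only [diffOp, IntDiffOp.formal_sum, IntDiffOp.formal_mul, IntDiffOp.formal_pow, formal_Dx,
    formal_mulFn]

end Calculus

end Action

/-! ### Matrix functions with entries in a given class -/

section MatrixClasses

variable {𝓐 : Type*} [CommRing 𝓐] [Algebra ℂ 𝓐] {m n p : ℕ}

/-- All entries of the matrix function lie in `S`. -/
def EntriesIn (S : Submodule ℂ 𝓐) (f : Matrix (Fin m) (Fin n) 𝓐) : Prop := ∀ i j, f i j ∈ S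

variable {S S₁ S₂ : Submodule ℂ 𝓐} {f g : Matrix (Fin m) (Fin n) 𝓐}

theorem EntriesIn.add (hf : EntriesIn S f) (hg : EntriesIn S g) : EntriesIn S (f + g) :=
  fun i j => S.add_mem (hf i j) (hg i j)

theorem EntriesIn.sub (hf : EntriesIn S f) (hg : EntriesIn S g) : EntriesIn S (f - g) :=
  fun i j => S.sub_mem (hf i j) (hg i j)

theorem EntriesIn.neg (hf : EntriesIn S f) : EntriesIn S (-f) :=
  fun i j => S.neg_mem (hf i j)

theorem EntriesIn.smul (c : ℂ) (hf : EntriesIn S f) : EntriesIn S (c • f) :=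
  fun i j => S.smul_mem c (hf i j)

theorem EntriesIn.transpose (hf : EntriesIn S f) : EntriesIn S f.transpose :=
  fun i j => hf j i

theorem EntriesIn.mul {h : Matrix (Fin n) (Fin p) 𝓐}
    (hS : ∀ a ∈ S₁, ∀ b ∈ S₂, a * b ∈ S) (hf : EntriesIn S₁ f) (hh : EntriesIn S₂ h) :
    EntriesIn S (f * h) := fun i j => by
  rw [Matrix.mul_apply]
  exact S.sum_mem fun k _ => hS _ (hf i k) _ (hh k j)

theorem entriesIn_map {T : 𝓐 → 𝓐} (hT : ∀ a ∈ S₁, T a ∈ S₂) (hf : EntriesIn S₁ f) :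
    EntriesIn S₂ (f.map T) := fun i j => hT _ (hf i j)

theorem map_derivation_mul (δ : Derivation ℂ 𝓐 𝓐) (f : Matrix (Fin m) (Fin n) 𝓐)
    (g : Matrix (Fin n) (Fin p) 𝓐) : (f * g).map δ = f.map δ * g + f * g.map δ := by
  ext i j
  simp [Matrix.mul_apply, Finset.sum_add_distrib, add_comm, mul_comm]

end MatrixClasses

/-! ### Integration on function classes and integration by parts -/

section Dressing

variable {𝓐 : Type*} [CommRing 𝓐] [Algebra ℂ 𝓐]

/-- Function classes on which the integration of a calculus inverts its `x`-derivative. -/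
structure Calculus.Classes (𝒞 : Calculus 𝓐) where
  coeff : Subalgebra ℂ 𝓐
  integrable : Submodule ℂ 𝓐
  right : Submodule ℂ 𝓐
  left : Submodule ℂ 𝓐
  integrable_le : ∀ f ∈ integrable, f ∈ coeff
  mul_integrable : ∀ a ∈ coeff, ∀ f ∈ integrable, a * f ∈ integrable
  mul_right : ∀ a ∈ coeff, ∀ f ∈ right, a * f ∈ right
  mul_left : ∀ a ∈ coeff, ∀ f ∈ left, a * f ∈ left
  left_mul_right : ∀ g ∈ left, ∀ f ∈ right, g * f ∈ integrable
  dτ_integrable : ∀ f ∈ integrable, 𝒞.dτ f ∈ integrable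
  dt_integrable : ∀ f ∈ integrable, 𝒞.dt f ∈ integrable
  dx_right : ∀ f ∈ right, 𝒞.dx f ∈ right
  dτ_right : ∀ f ∈ right, 𝒞.dτ f ∈ right
  dt_right : ∀ f ∈ right, 𝒞.dt f ∈ right
  dx_left : ∀ f ∈ left, 𝒞.dx f ∈ left
  dτ_left : ∀ f ∈ left, 𝒞.dτ f ∈ left
  dt_left : ∀ f ∈ left, 𝒞.dt f ∈ left
  int_mem : ∀ f ∈ integrable, 𝒞.int f ∈ integrable
  dx_int : ∀ f ∈ integrable, 𝒞.dx (𝒞.int f) = f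
  int_dx : ∀ f ∈ integrable, 𝒞.int (𝒞.dx f) = f
  dτ_dx : ∀ f, 𝒞.dτ (𝒞.dx f) = 𝒞.dx (𝒞.dτ f)
  dt_dx : ∀ f, 𝒞.dt (𝒞.dx f) = 𝒞.dx (𝒞.dt f)

/-- Matrix functions with entries in a class of coefficients. -/
abbrev Calculus.Classes.coeffs {𝒞 : Calculus 𝓐} (σ : 𝒞.Classes) : Submodule ℂ 𝓐 :=
  Subalgebra.toSubmodule σ.coeff

namespace Calculus

variable {𝒞 : Calculus 𝓐} {N K m n p : ℕ}

theorem int_map_add (f g : Matrix (Fin m) (Fin n) 𝓐) :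
    (f + g).map 𝒞.int = f.map 𝒞.int + g.map 𝒞.int := Matrix.map_add _ (map_add 𝒞.int) f g

theorem int_map_neg (f : Matrix (Fin m) (Fin n) 𝓐) :
    (-f).map 𝒞.int = -f.map 𝒞.int := by
  ext i j; exact map_neg 𝒞.int _

namespace Classes

variable (σ : 𝒞.Classes) {f : Matrix (Fin m) (Fin n) 𝓐} {g : Matrix (Fin n) (Fin p) 𝓐}

theorem left_mul_right_mat (hf : EntriesIn σ.left f) (hg : EntriesIn σ.right g) :
    EntriesIn σ.integrable (f * g) := hf.mul σ.left_mul_right hg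

theorem right_mul_left_mat (hf : EntriesIn σ.right f) (hg : EntriesIn σ.left g) :
    EntriesIn σ.integrable (f * g) :=
  hf.mul (fun a ha b hb => by rw [mul_comm]; exact σ.left_mul_right b hb a ha) hg

theorem coeff_mul_integrable (hf : EntriesIn σ.coeffs f) (hg : EntriesIn σ.integrable g) :
    EntriesIn σ.integrable (f * g) := hf.mul σ.mul_integrable hg

theorem integrable_mul_coeff (hf : EntriesIn σ.integrable f) (hg : EntriesIn σ.coeffs g) :
    EntriesIn σ.integrable (f * g) :=
  hf.mul (fun a ha b hb => by rw [mul_comm]; exact σ.mul_integrable b hb a ha) hg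

theorem coeff_mul_right (hf : EntriesIn σ.coeffs f) (hg : EntriesIn σ.right g) :
    EntriesIn σ.right (f * g) := hf.mul σ.mul_right hg

theorem right_mul_coeff (hf : EntriesIn σ.right f) (hg : EntriesIn σ.coeffs g) :
    EntriesIn σ.right (f * g) :=
  hf.mul (fun a ha b hb => by rw [mul_comm]; exact σ.mul_right b hb a ha) hg

theorem coeff_mul_left (hf : EntriesIn σ.coeffs f) (hg : EntriesIn σ.left g) :
    EntriesIn σ.left (f * g) := hf.mul σ.mul_left hg

theorem left_mul_coeff (hf : EntriesIn σ.left f) (hg : EntriesIn σ.coeffs g) :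
    EntriesIn σ.left (f * g) :=
  hf.mul (fun a ha b hb => by rw [mul_comm]; exact σ.mul_left b hb a ha) hg

theorem integrable_coeff (hf : EntriesIn σ.integrable f) : EntriesIn σ.coeffs f :=
  fun i j => σ.integrable_le _ (hf i j)

theorem const_coeff (X : Matrix (Fin m) (Fin n) ℂ) : EntriesIn σ.coeffs (const 𝓐 X) :=
  fun i j => σ.coeff.algebraMap_mem (X i j)

theorem int_integrable (hf : EntriesIn σ.integrable f) : EntriesIn σ.integrable (f.map 𝒞.int) :=
  entriesIn_map σ.int_mem hf

theorem dx_int_mat (hf : EntriesIn σ.integrable f) : (f.map 𝒞.int).map 𝒞.dx = f := by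
  ext i j; exact σ.dx_int _ (hf i j)

theorem int_dx_mat (hf : EntriesIn σ.integrable f) : (f.map 𝒞.dx).map 𝒞.int = f := by
  ext i j; exact σ.int_dx _ (hf i j)

/-- Integration by parts. -/
theorem int_by_parts (hf : EntriesIn σ.left f) (hg : EntriesIn σ.right g) :
    (f.map 𝒞.dx * g).map 𝒞.int = f * g - (f * g.map 𝒞.dx).map 𝒞.int := by
  rw [eq_sub_iff_add_eq, ← int_map_add, ← map_derivation_mul,
    σ.int_dx_mat (σ.left_mul_right_mat hf hg)]

/-- Write $f=D\{D^{-1}\{f\}\}$ and move $\delta$ past $D$. Then $\delta f$ is the $x$-derivative of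
the integrable function $\delta D^{-1}\{f\}$, and integrating returns it. -/
theorem int_comm_mat {δ : Derivation ℂ 𝓐 𝓐} (hδ : ∀ a, δ (𝒞.dx a) = 𝒞.dx (δ a))
    (hI : ∀ a ∈ σ.integrable, δ a ∈ σ.integrable) (hf : EntriesIn σ.integrable f) :
    (f.map δ).map 𝒞.int = (f.map 𝒞.int).map δ := by
  ext i j
  simp only [Matrix.map_apply]
  have h := σ.int_mem _ (hf i j)
  conv_lhs => rw [← σ.dx_int _ (hf i j), hδ, σ.int_dx _ (hI _ h)]

/-- `D^{-1} f D^{-1} = D^{-1}{f} D^{-1} - D^{-1} D^{-1}{f}`. -/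
theorem Dinv_mul_fnMat_mul_Dinv (hf : EntriesIn σ.integrable f) :
    scalarMat m (PDO.Dinv 𝒞.dx) * fnMat f * scalarMat n (PDO.Dinv 𝒞.dx) =
      fnMat (f.map 𝒞.int) * scalarMat n (PDO.Dinv 𝒞.dx) -
        scalarMat m (PDO.Dinv 𝒞.dx) * fnMat (f.map 𝒞.int) := by
  have := Dinv_fnMat_Dinv 𝒞.dx (f.map 𝒞.int)
  rwa [σ.dx_int_mat hf] at this

theorem iterate_dx_right (hf : EntriesIn σ.right f) (j : ℕ) :
    EntriesIn σ.right ((fun h => h.map 𝒞.dx)^[j] f) := by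
  induction j with
  | zero => exact hf
  | succ j ih => rw [Function.iterate_succ_apply']; exact entriesIn_map σ.dx_right ih

/-- `D^{-1} gᵀ D^j f D^{-1}` up to a differential operator. -/
theorem Dinv_fnMat_D_pow_fnMat_Dinv {φ : Matrix (Fin N) (Fin K) 𝓐} (hφ : EntriesIn σ.right φ)
    (j : ℕ) : ∀ {g : Matrix (Fin N) (Fin m) 𝓐}, EntriesIn σ.left g →
    ∃ R ∈ diffOps 𝒞.dx m K j, scalarMat m (PDO.Dinv 𝒞.dx) * fnMat g.transpose *
        scalarMat N (PDO.D 𝒞.dx) ^ j * fnMat φ * scalarMat K (PDO.Dinv 𝒞.dx) =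
      fnMat ((g.transpose * (fun h => h.map 𝒞.dx)^[j] φ).map 𝒞.int) *
          scalarMat K (PDO.Dinv 𝒞.dx) -
        scalarMat m (PDO.Dinv 𝒞.dx) *
          fnMat ((((fun h => -h.map 𝒞.dx)^[j] g).transpose * φ).map 𝒞.int) + R := by
  induction j with
  | zero =>
    intro g hg
    refine ⟨0, zero_mem _, ?_⟩
    rw [pow_zero, Matrix.mul_one, Matrix.mul_assoc (_ * _), Matrix.mul_assoc, ← Matrix.mul_assoc (fnMat _),
      ← fnMat_mul, ← Matrix.mul_assoc,
      σ.Dinv_mul_fnMat_mul_Dinv (σ.left_mul_right_mat hg.transpose hφ), add_zero]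
    rfl
  | succ j ih =>
    intro g hg
    have hg' : EntriesIn σ.left (g.map 𝒞.dx) := entriesIn_map σ.dx_left hg
    -- One factor $D$ is absorbed by $D^{-1}g^\top D=g^\top-D^{-1}g'^\top$. The first piece is
    -- handled by `D_pow_fnMat_Dinv`, the second by induction with $-g'$ in place of $g$, which is
    -- why $g$ is quantified inside the induction. Integration by parts then cancels the extra
    -- $g^\top\varphi^{(j)}D^{-1}$.
    obtain ⟨R, hR, h⟩ := ih hg'.neg
    obtain ⟨P, hP, hP'⟩ := D_pow_fnMat_Dinv 𝒞.dx φ j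
    have hj := σ.iterate_dx_right hφ j
    refine ⟨fnMat g.transpose * P + R, add_mem
      (fnMat_mul_mem_diffOps (diffOps_mono (Nat.le_succ j) hP) _)
      (diffOps_mono (Nat.le_succ j) hR), ?_⟩
    rw [pow_succ', ← Matrix.mul_assoc, Dinv_fnMat_D, Matrix.sub_mul, Matrix.sub_mul,
      Matrix.sub_mul, Matrix.mul_assoc, Matrix.mul_assoc, ← Matrix.mul_assoc (_ ^ j), hP']
    rw [Matrix.transpose_neg, fnMat_neg, Matrix.mul_neg, Matrix.neg_mul, Matrix.neg_mul,
      Matrix.neg_mul, neg_eq_iff_eq_neg] at h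
    rw [Matrix.transpose_map, h, Function.iterate_succ_apply _ j g, Function.iterate_succ_apply' _ j φ,
      Matrix.neg_mul, int_map_neg, fnMat_neg, ← Matrix.transpose_map,
      σ.int_by_parts (f := g.transpose) hg.transpose hj, fnMat_sub, fnMat_mul, Matrix.mul_add]
    simp only [Matrix.sub_mul, Matrix.neg_mul, Matrix.mul_assoc]
    abel

end Classes

end Calculus

end Dressing

/-! ### The operator $W$, its inverse, and conjugation by it -/

section Transformation

variable {𝓐 : Type*} [CommRing 𝓐] [Algebra ℂ 𝓐] {𝒞 : Calculus 𝓐} {N K m : ℕ}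
  {C : Matrix (Fin K) (Fin K) ℂ} {φ ψ : Matrix (Fin N) (Fin K) 𝓐}

namespace Calculus

theorem act_W (f : Matrix (Fin N) (Fin m) 𝓐) : (𝒞.W C φ ψ).act f =
    f - 𝒞.Phi C φ ψ * (ψ.transpose * f).map 𝒞.int := rfl

theorem act_Winv (f : Matrix (Fin N) (Fin m) 𝓐) : (𝒞.Winv C φ ψ).act f =
    f + φ * ((𝒞.Psi C φ ψ).transpose * f).map 𝒞.int := rfl

theorem actT_W (g : Matrix (Fin N) (Fin m) 𝓐) : (𝒞.W C φ ψ).actT g =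
    g + ψ * ((𝒞.Phi C φ ψ).transpose * g).map 𝒞.int := by
  change g - -(ψ * ((𝒞.Phi C φ ψ).transpose * g).map 𝒞.int) = _
  rw [sub_neg_eq_add]

theorem actT_Winv (g : Matrix (Fin N) (Fin m) 𝓐) : (𝒞.Winv C φ ψ).actT g =
    g - 𝒞.Psi C φ ψ * (φ.transpose * g).map 𝒞.int := by
  change g + -(𝒞.Psi C φ ψ * (φ.transpose * g).map 𝒞.int) = _
  rw [sub_eq_add_neg]

theorem transpose_actT_Winv (g : Matrix (Fin N) (Fin m) 𝓐) :
    ((𝒞.Winv C φ ψ).actT g).transpose =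
      g.transpose - (g.transpose * φ).map 𝒞.int * (𝒞.Psi C φ ψ).transpose := by
  rw [actT_Winv, Matrix.transpose_sub, Matrix.transpose_mul, ← Matrix.transpose_map,
    Matrix.transpose_mul, Matrix.transpose_transpose]

theorem formal_W : (𝒞.W C φ ψ).formal =
    1 - fnMat (𝒞.Phi C φ ψ) * scalarMat K (PDO.Dinv 𝒞.dx) * fnMat ψ.transpose := rfl

theorem formal_Winv : (𝒞.Winv C φ ψ).formal =
    1 + fnMat φ * scalarMat K (PDO.Dinv 𝒞.dx) * fnMat (𝒞.Psi C φ ψ).transpose := rfl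

theorem transpose_Psi :
    (𝒞.Psi C φ ψ).transpose = (𝒞.Delta C φ ψ)⁻¹ * ψ.transpose := by
  rw [Psi, Matrix.transpose_mul, Matrix.transpose_transpose]

theorem int_transpose_mul : (ψ.transpose * φ).map 𝒞.int = 𝒞.Delta C φ ψ - const 𝓐 C := by
  rw [Delta, add_sub_cancel_left]

theorem map_derivation_const (δ : Derivation ℂ 𝓐 𝓐) : (const 𝓐 C).map δ = 0 := by
  ext i j
  simp [const]

theorem Phi_mul_Delta (hΔ : IsUnit (𝒞.Delta C φ ψ).det) :
    𝒞.Phi C φ ψ * 𝒞.Delta C φ ψ = φ := by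
  rw [Phi, Matrix.mul_assoc, Matrix.nonsing_inv_mul _ hΔ, Matrix.mul_one]

theorem Delta_mul_transpose_Psi (hΔ : IsUnit (𝒞.Delta C φ ψ).det) :
    𝒞.Delta C φ ψ * (𝒞.Psi C φ ψ).transpose = ψ.transpose := by
  rw [transpose_Psi, ← Matrix.mul_assoc, Matrix.mul_nonsing_inv _ hΔ, Matrix.one_mul]

/-- `W{φ} = Φ C`. -/
theorem act_W_self (hΔ : IsUnit (𝒞.Delta C φ ψ).det) :
    (𝒞.W C φ ψ).act φ = 𝒞.Phi C φ ψ * const 𝓐 C := by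
  rw [act_W, int_transpose_mul (C := C), Matrix.mul_sub, Phi_mul_Delta hΔ, sub_sub_cancel]

/-- `(W^{-1})^τ{ψ} = Ψ Cᵀ`. -/
theorem actT_Winv_self (hΔ : IsUnit (𝒞.Delta C φ ψ).det) :
    (𝒞.Winv C φ ψ).actT ψ = 𝒞.Psi C φ ψ * const 𝓐 C.transpose := by
  apply Matrix.transpose_injective
  rw [transpose_actT_Winv, int_transpose_mul (C := C), Matrix.sub_mul, Delta_mul_transpose_Psi hΔ,
    sub_sub_cancel, Matrix.transpose_mul, const_transpose, Matrix.transpose_transpose]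

variable (σ : 𝒞.Classes)

namespace Classes

section
variable (hφ : EntriesIn σ.right φ) (hψ : EntriesIn σ.left ψ)
  (hΔ : IsUnit (𝒞.Delta C φ ψ).det)
include hφ hψ

theorem dx_Delta : (𝒞.Delta C φ ψ).map 𝒞.dx = ψ.transpose * φ := by
  rw [Delta, Matrix.map_add _ (map_add 𝒞.dx), map_derivation_const, zero_add,
    σ.dx_int_mat (σ.left_mul_right_mat hψ.transpose hφ)]

theorem derivation_Delta {δ : Derivation ℂ 𝓐 𝓐} (hδ : ∀ a, δ (𝒞.dx a) = 𝒞.dx (δ a))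
    (hI : ∀ a ∈ σ.integrable, δ a ∈ σ.integrable) : (𝒞.Delta C φ ψ).map δ =
      (ψ.transpose.map δ * φ).map 𝒞.int + (ψ.transpose * φ.map δ).map 𝒞.int := by
  rw [Delta, Matrix.map_add _ (map_add δ), map_derivation_const, zero_add,
    ← σ.int_comm_mat hδ hI (σ.left_mul_right_mat hψ.transpose hφ), map_derivation_mul,
    int_map_add]

/-- Any primitive of $\psi^\top\varphi$ may be used here. Choosing $\Delta$, which includes the
constant $C$, is what makes the products with $\Phi$ and $\Psi$ simplify. -/
theorem Dinv_Delta_Dinv :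
    scalarMat K (PDO.Dinv 𝒞.dx) * fnMat (ψ.transpose * φ) * scalarMat K (PDO.Dinv 𝒞.dx) =
      fnMat (𝒞.Delta C φ ψ) * scalarMat K (PDO.Dinv 𝒞.dx) -
        scalarMat K (PDO.Dinv 𝒞.dx) * fnMat (𝒞.Delta C φ ψ) := by
  rw [← Dinv_fnMat_Dinv, σ.dx_Delta hφ hψ]

include hΔ

theorem dx_inv_Delta : ((𝒞.Delta C φ ψ)⁻¹).map 𝒞.dx =
    -((𝒞.Delta C φ ψ)⁻¹ * (ψ.transpose * φ) * (𝒞.Delta C φ ψ)⁻¹) := by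
  have h := congrArg (fun X => X.map 𝒞.dx) (Matrix.mul_nonsing_inv _ hΔ)
  have h1 : (1 : Matrix (Fin K) (Fin K) 𝓐).map 𝒞.dx = 0 := by
    rw [← const_one]; exact map_derivation_const _
  simp only [map_derivation_mul, h1, σ.dx_Delta hφ hψ] at h
  rw [Matrix.mul_assoc, ← Matrix.mul_neg, eq_neg_of_add_eq_zero_left h, neg_neg,
    ← Matrix.mul_assoc, Matrix.nonsing_inv_mul _ hΔ, Matrix.one_mul]

/-- The product of the two integral terms is $\Phi(\Delta D^{-1}-D^{-1}\Delta)\Psi^\top$. By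
$\Phi\Delta=\varphi$ and $\Delta\Psi^\top=\psi^\top$ it cancels the terms linear in $D^{-1}$. -/
theorem formal_W_mul_Winv : (𝒞.W C φ ψ).formal * (𝒞.Winv C φ ψ).formal = 1 := by
  have h : fnMat (𝒞.Phi C φ ψ) * scalarMat K (PDO.Dinv 𝒞.dx) * fnMat ψ.transpose *
      (fnMat φ * scalarMat K (PDO.Dinv 𝒞.dx) * fnMat (𝒞.Psi C φ ψ).transpose) =
      fnMat (𝒞.Phi C φ ψ) * (scalarMat K (PDO.Dinv 𝒞.dx) * fnMat (ψ.transpose * φ) *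
        scalarMat K (PDO.Dinv 𝒞.dx)) * fnMat (𝒞.Psi C φ ψ).transpose := by
    simp only [fnMat_mul, Matrix.mul_assoc]
  rw [formal_W, formal_Winv, Matrix.sub_mul, Matrix.one_mul, Matrix.mul_add, Matrix.mul_one, h,
    σ.Dinv_Delta_Dinv hφ hψ (C := C), Matrix.mul_sub, Matrix.sub_mul, ← Matrix.mul_assoc,
    ← fnMat_mul, Phi_mul_Delta hΔ, Matrix.mul_assoc _ _ (fnMat (𝒞.Psi C φ ψ).transpose),
    Matrix.mul_assoc _ _ (fnMat (𝒞.Psi C φ ψ).transpose),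
    Matrix.mul_assoc _ (fnMat _) (fnMat (𝒞.Psi C φ ψ).transpose), ← fnMat_mul,
    Delta_mul_transpose_Psi hΔ]
  simp only [Matrix.mul_assoc]
  abel

/-- In this order the middle factor is
$\Psi^\top\Phi=\Delta^{-1}\psi^\top\varphi\Delta^{-1}=-D\{\Delta^{-1}\}$, so the product of integral
terms is again a commutator with $D^{-1}$. -/
theorem formal_Winv_mul_W : (𝒞.Winv C φ ψ).formal * (𝒞.W C φ ψ).formal = 1 := by
  have h : fnMat φ * scalarMat K (PDO.Dinv 𝒞.dx) * fnMat (𝒞.Psi C φ ψ).transpose *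
      (fnMat (𝒞.Phi C φ ψ) * scalarMat K (PDO.Dinv 𝒞.dx) * fnMat ψ.transpose) =
      -(fnMat φ * (scalarMat K (PDO.Dinv 𝒞.dx) * fnMat (((𝒞.Delta C φ ψ)⁻¹).map 𝒞.dx) *
        scalarMat K (PDO.Dinv 𝒞.dx)) * fnMat ψ.transpose) := by
    rw [σ.dx_inv_Delta hφ hψ hΔ, fnMat_neg, transpose_Psi, Phi]
    simp only [fnMat_mul, Matrix.mul_assoc, Matrix.neg_mul, Matrix.mul_neg, neg_neg]
  rw [formal_W, formal_Winv, Matrix.add_mul, Matrix.one_mul, Matrix.mul_sub, Matrix.mul_one, h,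
    Dinv_fnMat_Dinv, transpose_Psi, Phi]
  simp only [fnMat_mul, Matrix.mul_sub, Matrix.sub_mul, Matrix.mul_assoc]
  abel

end

section
variable (hφ : EntriesIn σ.right φ) (hψ : EntriesIn σ.left ψ)
  (hΔ : IsUnit (𝒞.Delta C φ ψ).det) (hΔF : EntriesIn σ.coeffs (𝒞.Delta C φ ψ)⁻¹)
include hφ hψ hΔ hΔF

/-- On functions, integration inverts $D$ only on the integrable class, so the formal identity does
not settle this. The point is that $\Psi^\top W\{f\}$ is the derivative of
$\Delta^{-1}D^{-1}\{\psi^\top f\}$, which is integrable because $\Delta^{-1}$ has entries in the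
coefficient algebra. -/
theorem act_Winv_act_W {f : Matrix (Fin N) (Fin m) 𝓐} (hf : EntriesIn σ.right f) :
    (𝒞.Winv C φ ψ).act ((𝒞.W C φ ψ).act f) = f := by
  have hI := σ.left_mul_right_mat hψ.transpose hf
  have hH := σ.int_dx_mat (σ.coeff_mul_integrable hΔF (σ.int_integrable hI))
  rw [map_derivation_mul, σ.dx_int_mat hI, σ.dx_inv_Delta hφ hψ hΔ] at hH
  have h : (𝒞.Psi C φ ψ).transpose * (𝒞.W C φ ψ).act f =
      -((𝒞.Delta C φ ψ)⁻¹ * (ψ.transpose * φ) * (𝒞.Delta C φ ψ)⁻¹) *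
        (ψ.transpose * f).map 𝒞.int + (𝒞.Delta C φ ψ)⁻¹ * (ψ.transpose * f) := by
    rw [act_W, transpose_Psi, Phi]
    simp only [Matrix.mul_sub, Matrix.neg_mul, Matrix.mul_assoc]
    abel
  rw [act_Winv, h, hH, act_W, Phi, Matrix.mul_assoc, sub_add_cancel]

/-- The mirror argument: $((W^{-1})^\tau\{g\})^\top\Phi$ is the derivative of
$D^{-1}\{g^\top\varphi\}\Delta^{-1}$. -/
theorem actT_W_actT_Winv {g : Matrix (Fin N) (Fin m) 𝓐} (hg : EntriesIn σ.left g) :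
    (𝒞.W C φ ψ).actT ((𝒞.Winv C φ ψ).actT g) = g := by
  have hI := σ.left_mul_right_mat hg.transpose hφ
  have hH := σ.int_dx_mat (σ.integrable_mul_coeff (σ.int_integrable hI) hΔF)
  rw [map_derivation_mul, σ.dx_int_mat hI, σ.dx_inv_Delta hφ hψ hΔ] at hH
  have h : ((𝒞.Winv C φ ψ).actT g).transpose * 𝒞.Phi C φ ψ =
      (g.transpose * φ) * (𝒞.Delta C φ ψ)⁻¹ + (g.transpose * φ).map 𝒞.int *
        -((𝒞.Delta C φ ψ)⁻¹ * (ψ.transpose * φ) * (𝒞.Delta C φ ψ)⁻¹) := by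
    rw [transpose_actT_Winv, transpose_Psi, Phi]
    simp only [Matrix.sub_mul, Matrix.mul_neg, Matrix.mul_assoc]
    abel
  apply Matrix.transpose_injective
  rw [actT_W, Matrix.transpose_add, Matrix.transpose_mul, ← Matrix.transpose_map,
    Matrix.transpose_mul, Matrix.transpose_transpose, h, hH, transpose_actT_Winv, transpose_Psi,
    Matrix.mul_assoc, sub_add_cancel]

end

end Classes

/-- The dressed operator `W A W^{-1}` with its integral terms
`W{A{φ}} D^{-1} Ψᵀ - Φ D^{-1} (W^{-1})^τ{A^τ{ψ}}ᵀ` removed. -/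
def dressedPart (𝒞 : Calculus 𝓐) (C : Matrix (Fin K) (Fin K) ℂ) (φ ψ : Matrix (Fin N) (Fin K) 𝓐) :
    IntDiffOp 𝓐 N →ₗ[ℂ] Matrix (Fin N) (Fin N) (PDO 𝓐) where
  toFun A := (𝒞.W C φ ψ).formal * A.formal * (𝒞.Winv C φ ψ).formal
    - fnMat ((𝒞.W C φ ψ).act (A.act φ)) * scalarMat K (PDO.Dinv 𝒞.dx) *
      fnMat (𝒞.Psi C φ ψ).transpose
    + fnMat (𝒞.Phi C φ ψ) * scalarMat K (PDO.Dinv 𝒞.dx) *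
      fnMat ((𝒞.Winv C φ ψ).actT (A.actT ψ)).transpose
  map_add' A B := by
    simp only [IntDiffOp.formal_add, IntDiffOp.act_add_left, IntDiffOp.actT_add_left,
      IntDiffOp.act_add, IntDiffOp.actT_add, Matrix.transpose_add, fnMat_add, Matrix.mul_add,
      Matrix.add_mul]
    abel
  map_smul' c A := by
    simp only [IntDiffOp.formal_smul, IntDiffOp.act_smul_left, IntDiffOp.actT_smul_left,
      IntDiffOp.act_smul, IntDiffOp.actT_smul, Matrix.transpose_smul, fnMat_smul, Matrix.mul_smul,
      Matrix.smul_mul, smul_add, smul_sub, RingHom.id_apply]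

theorem dressedPart_apply (A : IntDiffOp 𝓐 N) : 𝒞.dressedPart C φ ψ A =
    (𝒞.W C φ ψ).formal * A.formal * (𝒞.Winv C φ ψ).formal
    - fnMat ((𝒞.W C φ ψ).act (A.act φ)) * scalarMat K (PDO.Dinv 𝒞.dx) *
      fnMat (𝒞.Psi C φ ψ).transpose
    + fnMat (𝒞.Phi C φ ψ) * scalarMat K (PDO.Dinv 𝒞.dx) *
      fnMat ((𝒞.Winv C φ ψ).actT (A.actT ψ)).transpose := rfl

/-- Isolates the three products to be evaluated for each kind of operator: $X\varphi D^{-1}$,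
$D^{-1}\psi^\top X$ and $D^{-1}\psi^\top X\varphi D^{-1}$. -/
theorem formal_conj (X : Matrix (Fin N) (Fin N) (PDO 𝓐)) :
    (𝒞.W C φ ψ).formal * X * (𝒞.Winv C φ ψ).formal =
      X + X * fnMat φ * scalarMat K (PDO.Dinv 𝒞.dx) * fnMat (𝒞.Psi C φ ψ).transpose
      - fnMat (𝒞.Phi C φ ψ) * (scalarMat K (PDO.Dinv 𝒞.dx) * fnMat ψ.transpose * X)
      - fnMat (𝒞.Phi C φ ψ) * (scalarMat K (PDO.Dinv 𝒞.dx) * fnMat ψ.transpose * X * fnMat φ *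
        scalarMat K (PDO.Dinv 𝒞.dx)) * fnMat (𝒞.Psi C φ ψ).transpose := by
  rw [formal_W, formal_Winv]
  simp only [Matrix.mul_add, Matrix.sub_mul, Matrix.mul_one, Matrix.one_mul, Matrix.mul_assoc]
  abel

namespace Classes

/-- Each of the three products equals an explicit integral term plus a differential operator. With
$g=u^\top\psi$, the integral terms involve $u\varphi^{(j)}=A\{\varphi\}$ and
$(-D)^jg=A^\tau\{\psi\}$ for $A=uD^j$, and together they are exactly what `dressedPart` subtracts.
The remainders $P$, $Q$, $R$ have order at most $j$. -/
theorem dressedPart_mulFn_mul_Dx_pow (hφ : EntriesIn σ.right φ) (hψ : EntriesIn σ.left ψ)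
    {u : Matrix (Fin N) (Fin N) 𝓐} (hu : EntriesIn σ.coeffs u) (j : ℕ) :
    𝒞.dressedPart C φ ψ (mulFn u * 𝒞.Dx ^ j) ∈ diffOps 𝒞.dx N N j := by
  have hg : EntriesIn σ.left (u.transpose * ψ) := σ.coeff_mul_left hu.transpose hψ
  obtain ⟨P, hP, hP'⟩ := D_pow_fnMat_Dinv 𝒞.dx φ j
  obtain ⟨Q, hQ, hQ'⟩ := Dinv_fnMat_D_pow 𝒞.dx (u.transpose * ψ) j
  obtain ⟨R, hR, hR'⟩ := σ.Dinv_fnMat_D_pow_fnMat_Dinv hφ j hg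
  have key : 𝒞.dressedPart C φ ψ (mulFn u * 𝒞.Dx ^ j) =
      fnMat u * scalarMat N (PDO.D 𝒞.dx) ^ j + fnMat u * (P * fnMat (𝒞.Psi C φ ψ).transpose)
        - fnMat (𝒞.Phi C φ ψ) * Q
        - fnMat (𝒞.Phi C φ ψ) * (R * fnMat (𝒞.Psi C φ ψ).transpose) := by
    have hE : scalarMat K (PDO.Dinv 𝒞.dx) * fnMat ψ.transpose *
        (fnMat u * scalarMat N (PDO.D 𝒞.dx) ^ j) =
        scalarMat K (PDO.Dinv 𝒞.dx) * fnMat (u.transpose * ψ).transpose *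
          scalarMat N (PDO.D 𝒞.dx) ^ j := by
      rw [Matrix.transpose_mul, Matrix.transpose_transpose, fnMat_mul]
      simp only [Matrix.mul_assoc]
    rw [dressedPart_apply, formal_conj, IntDiffOp.formal_mul, formal_mulFn, IntDiffOp.formal_pow,
      formal_Dx, hE, hR', hQ', IntDiffOp.act_mul, act_mulFn, act_Dx_pow, IntDiffOp.actT_mul,
      actT_mulFn, actT_Dx_pow, transpose_actT_Winv, act_W, Matrix.mul_assoc (fnMat u),
      Matrix.mul_assoc (fnMat u), hP', Matrix.transpose_mul, Matrix.transpose_transpose,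
      Matrix.mul_assoc ψ.transpose]
    simp only [fnMat_sub, fnMat_mul, Matrix.mul_add, Matrix.add_mul, Matrix.mul_sub,
      Matrix.sub_mul, Matrix.mul_assoc]
    abel
  rw [key]
  exact sub_mem (sub_mem (add_mem (fnMat_mul_D_pow_mem_diffOps le_rfl _)
    (fnMat_mul_mem_diffOps (mul_fnMat_mem_diffOps hP _) _)) (fnMat_mul_mem_diffOps hQ _))
    (fnMat_mul_mem_diffOps (mul_fnMat_mem_diffOps hR _) _)

theorem exists_dressedPart_diffOp (hφ : EntriesIn σ.right φ) (hψ : EntriesIn σ.left ψ) {k : ℕ}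
    {u : Fin (k + 1) → Matrix (Fin N) (Fin N) 𝓐} (hu : ∀ j, EntriesIn σ.coeffs (u j)) :
    ∃ w : Fin (k + 1) → Matrix (Fin N) (Fin N) 𝓐,
      𝒞.dressedPart C φ ψ (𝒞.diffOp u) = (𝒞.diffOp w).formal := by
  simp only [formal_diffOp]
  apply exists_eq_sum_of_mem_diffOps
  rw [diffOp, map_sum]
  exact sum_mem fun j _ => diffOps_mono (Nat.lt_succ_iff.mp j.2)
    (σ.dressedPart_mulFn_mul_Dx_pow hφ hψ (hu j) j)

/-- With $G=D^{-1}\{g^\top\varphi\}$ and $H=D^{-1}\{\psi^\top f\}$, the expected answer is $(f-\Phi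
H)D^{-1}(g^\top-G\Psi^\top)$. The triple product with three factors $D^{-1}$ leaves a double
integral $J$, which also occurs in the subtracted terms and cancels. -/
theorem dressedPart_intOp (hφ : EntriesIn σ.right φ) (hψ : EntriesIn σ.left ψ)
    {f g : Matrix (Fin N) (Fin m) 𝓐} (hf : EntriesIn σ.right f) (hg : EntriesIn σ.left g) :
    𝒞.dressedPart C φ ψ (𝒞.intOp f g) =
      (𝒞.intOp ((𝒞.W C φ ψ).act f) ((𝒞.Winv C φ ψ).actT g)).formal := by
  have hG := σ.left_mul_right_mat hg.transpose hφ
  have hH := σ.left_mul_right_mat hψ.transpose hf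
  set G := (g.transpose * φ).map 𝒞.int with hGdef
  set H := (ψ.transpose * f).map 𝒞.int with hHdef
  have hGI : EntriesIn σ.integrable G := σ.int_integrable hG
  have hHI : EntriesIn σ.integrable H := σ.int_integrable hH
  have hHG := σ.integrable_mul_coeff hHI (σ.integrable_coeff hG)
  set J := (H * (g.transpose * φ)).map 𝒞.int with hJdef
  -- Integration by parts for the product $HG$, whose derivative is $\psi^\top fG+Hg^\top\varphi$.
  have hJ : (ψ.transpose * (f * G)).map 𝒞.int = H * G - J := by
    have h := σ.int_dx_mat (σ.integrable_mul_coeff hHI (σ.integrable_coeff hGI))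
    rw [map_derivation_mul, σ.dx_int_mat hG, σ.dx_int_mat hH, int_map_add] at h
    rw [← h, ← Matrix.mul_assoc, add_sub_cancel_right]
  have eG := σ.Dinv_mul_fnMat_mul_Dinv hG
  have eH := σ.Dinv_mul_fnMat_mul_Dinv hH
  have eJ := σ.Dinv_mul_fnMat_mul_Dinv hHG
  rw [← hGdef] at eG
  rw [← hHdef] at eH
  rw [← hJdef] at eJ
  set E := scalarMat m (PDO.Dinv 𝒞.dx) with hEdef
  set E' := scalarMat K (PDO.Dinv 𝒞.dx) with hEdef'
  have e1 : fnMat f * E * fnMat g.transpose * fnMat φ * E' =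
      fnMat f * (fnMat G * E' - E * fnMat G) := by
    rw [← eG]; simp only [fnMat_mul, Matrix.mul_assoc]
  have e2 : E' * fnMat ψ.transpose * (fnMat f * E * fnMat g.transpose) =
      (fnMat H * E - E' * fnMat H) * fnMat g.transpose := by
    rw [← eH]; simp only [fnMat_mul, Matrix.mul_assoc]
  have e3 : (fnMat H * E - E' * fnMat H) * fnMat g.transpose * fnMat φ * E' =
      fnMat H * (fnMat G * E' - E * fnMat G) - (fnMat J * E' - E' * fnMat J) := by
    rw [← eG, ← eJ]; simp only [fnMat_mul, Matrix.mul_assoc, Matrix.sub_mul]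
  have e4 : ((𝒞.Winv C φ ψ).actT ((𝒞.intOp f g).actT ψ)).transpose =
      -(H * g.transpose) + J * (𝒞.Psi C φ ψ).transpose := by
    rw [transpose_actT_Winv, actT_intOp, Matrix.transpose_neg, Matrix.transpose_mul,
      ← Matrix.transpose_map, Matrix.transpose_mul, Matrix.transpose_transpose, ← hHdef,
      Matrix.neg_mul, int_map_neg, Matrix.neg_mul, sub_neg_eq_add, Matrix.mul_assoc, ← hJdef]
  rw [dressedPart_apply, formal_conj, formal_intOp, formal_intOp, ← hEdef, e1, e2, e3, e4,
    act_intOp, ← hGdef, act_W, act_W, hJ, ← hHdef, transpose_actT_Winv, ← hGdef]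
  simp only [fnMat_sub, fnMat_mul, fnMat_add, fnMat_neg, Matrix.mul_add, Matrix.mul_sub,
    Matrix.sub_mul, Matrix.mul_neg, Matrix.mul_assoc]
  abel

/-- Evolution operators `T` with symbol commuting with `D` are left unchanged by dressing. -/
theorem dressedPart_evolution (hφ : EntriesIn σ.right φ) (hψ : EntriesIn σ.left ψ)
    (hΔ : IsUnit (𝒞.Delta C φ ψ).det) {δ : Derivation ℂ 𝓐 𝓐}
    (hδ : ∀ a, δ (𝒞.dx a) = 𝒞.dx (δ a)) (hI : ∀ a ∈ σ.integrable, δ a ∈ σ.integrable)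
    (hP : ∀ a ∈ σ.right, δ a ∈ σ.right)
    {T : PDO 𝓐} (hT : T.IsLeibniz δ) (hTD : Commute T (PDO.D 𝒞.dx)) {A : IntDiffOp 𝓐 N}
    (hA : A.formal = scalarMat N T) (hAφ : A.act φ = φ.map δ) (hAψ : A.actT ψ = -ψ.map δ) :
    𝒞.dressedPart C φ ψ A = A.formal := by
  have hcomm : scalarMat K T * scalarMat K (PDO.Dinv 𝒞.dx) =
      scalarMat K (PDO.Dinv 𝒞.dx) * scalarMat K T := by
    rw [scalarMat_mul_scalarMat, scalarMat_mul_scalarMat, (PDO.commute_Dinv hTD).eq]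
  have hφT := scalarMat_mul_fnMat hT φ
  have hψT := scalarMat_mul_fnMat hT ψ.transpose
  have hΔT := scalarMat_mul_fnMat hT (𝒞.Delta C φ ψ)
  have eΔ := σ.Dinv_Delta_Dinv hφ hψ (C := C)
  have eH := σ.Dinv_mul_fnMat_mul_Dinv
    (σ.left_mul_right_mat hψ.transpose (entriesIn_map hP hφ))
  have hΔδ := σ.derivation_Delta hφ hψ hδ hI (C := C)
  have hΦ := congrArg fnMat (Phi_mul_Delta hΔ)
  have hΨ := congrArg fnMat (Delta_mul_transpose_Psi hΔ)
  rw [dressedPart_apply, formal_conj, hA, hAφ, hAψ, act_W, transpose_actT_Winv,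
    Matrix.transpose_neg, Matrix.neg_mul, int_map_neg, Matrix.neg_mul, ← Matrix.transpose_map]
  set H := (ψ.transpose * φ.map δ).map 𝒞.int
  set H' := (ψ.transpose.map δ * φ).map 𝒞.int
  set E := scalarMat K (PDO.Dinv 𝒞.dx)
  set S := scalarMat N T
  set S' := scalarMat K T
  set fΦ := fnMat (𝒞.Phi C φ ψ)
  set fΨ := fnMat (𝒞.Psi C φ ψ).transpose
  set Δ := 𝒞.Delta C φ ψ
  rw [fnMat_mul] at hΦ hΨ eΔ eH
  rw [hΔδ, fnMat_add] at hΔT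
  have e1 : S * fnMat φ * E = fnMat φ * E * S' + fnMat (φ.map δ) * E := by
    rw [hφT, Matrix.add_mul, Matrix.mul_assoc, hcomm, Matrix.mul_assoc]
  have e2 : E * fnMat ψ.transpose * S * fnMat φ * E =
      (fnMat Δ * E - E * fnMat Δ) * S' + (fnMat H * E - E * fnMat H) := by
    rw [Matrix.mul_assoc _ S, Matrix.mul_assoc _ (S * _), e1, ← eΔ, ← eH]
    simp only [Matrix.mul_add, Matrix.mul_assoc]
  have e3 : E * fnMat ψ.transpose * S = E * (S' * fnMat ψ.transpose - fnMat (ψ.transpose.map δ)) := by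
    rw [hψT, add_sub_cancel_right, Matrix.mul_assoc]
  have e4 : fnMat Δ * S' = S' * fnMat Δ - (fnMat H' + fnMat H) := by
    rw [hΔT, add_sub_cancel_right]
  -- The commutator of $T$ with $\Delta$ is $\delta\Delta=H'+H$. The two terms still containing $T$
  -- cancel those coming from $T\varphi D^{-1}\Psi^\top$ and $\Phi D^{-1}\psi^\top T$; the terms in
  -- $H$ and $H'$ match the subtracted ones.
  have e5 : fΦ * (E * fnMat ψ.transpose * S * fnMat φ * E) * fΨ =
      fnMat φ * E * S' * fΨ - fΦ * E * S' * fnMat ψ.transpose + fΦ * E * fnMat H' * fΨ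
        + fΦ * fnMat H * E * fΨ := by
    rw [e2, ← hΦ, ← hΨ, Matrix.sub_mul, Matrix.mul_assoc E, e4]
    simp only [Matrix.mul_add, Matrix.add_mul, Matrix.mul_sub, Matrix.sub_mul, Matrix.mul_assoc]
    abel
  rw [e5, e1, e3]
  simp only [fnMat_sub, fnMat_mul, fnMat_neg, Matrix.add_mul, Matrix.mul_sub,
    Matrix.sub_mul, Matrix.mul_neg, Matrix.mul_assoc]
  abel

end Classes

end Calculus

end Transformation

/-! ### Eigenfunctions, intertwining and the telescoping sum -/

section DressedOperators

variable {𝓐 : Type*} [CommRing 𝓐] [Algebra ℂ 𝓐] {𝒞 : Calculus 𝓐} {N K m : ℕ}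
  {C : Matrix (Fin K) (Fin K) ℂ} {φ ψ : Matrix (Fin N) (Fin K) 𝓐}

namespace Calculus

theorem scalarMat_commute_const {T : PDO 𝓐} {δ : Derivation ℂ 𝓐 𝓐} (hT : T.IsLeibniz δ)
    (X : Matrix (Fin K) (Fin K) ℂ) :
    Commute (scalarMat K T) (fnMat (const 𝓐 X)) := by
  have h := scalarMat_mul_fnMat hT (const 𝓐 X)
  rwa [map_derivation_const, fnMat_zero, add_zero] at h

theorem Dinv_commute_const (X : Matrix (Fin K) (Fin K) ℂ) :
    Commute (scalarMat K (PDO.Dinv 𝒞.dx)) (fnMat (const 𝓐 X)) := by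
  have h := (scalarMat_commute_const (PDO.D_isLeibniz 𝒞.dx) X).eq
  change scalarMat K (PDO.Dinv 𝒞.dx) * fnMat (const 𝓐 X) = _ * _
  have h' : fnMat (const 𝓐 X) = scalarMat K (PDO.D 𝒞.dx) * fnMat (const 𝓐 X) *
      scalarMat K (PDO.Dinv 𝒞.dx) := by
    rw [h, mul_assoc, D_mul_Dinv_scalarMat, mul_one]
  conv_lhs => rw [h']
  rw [← mul_assoc, ← mul_assoc, Dinv_mul_D_scalarMat, one_mul]

/-- Constants commute with $D^{-1}$, so a constant on the right factor can be moved, transposed, to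
the left one. -/
theorem formal_intOp_mul_const (f g : Matrix (Fin N) (Fin m) 𝓐) (X Y : Matrix (Fin m) (Fin m) ℂ) :
    (𝒞.intOp (f * const 𝓐 X) (g * const 𝓐 Y)).formal =
      (𝒞.intOp (f * const 𝓐 (X * Y.transpose)) g).formal := by
  have h := (Dinv_commute_const (𝒞 := 𝒞) Y.transpose).eq
  rw [formal_intOp, formal_intOp, Matrix.transpose_mul, ← const_transpose, const_mul]
  simp only [fnMat_mul, Matrix.mul_assoc]
  rw [← Matrix.mul_assoc (scalarMat _ _), h, Matrix.mul_assoc]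

theorem const_smul (c : ℂ) (X : Matrix (Fin m) (Fin m) ℂ) :
    const 𝓐 (c • X) = c • const 𝓐 X := by
  ext i j
  simp only [const, Matrix.map_apply, Matrix.smul_apply]
  rw [smul_eq_mul, map_mul, Algebra.smul_def]

theorem formal_intOp_sum {ι : Type*} (s : Finset ι) (f g : Matrix (Fin N) (Fin m) 𝓐)
    (X : ι → Matrix (Fin m) (Fin m) ℂ) :
    ∑ i ∈ s, (𝒞.intOp (f * const 𝓐 (X i)) g).formal =
      (𝒞.intOp (f * const 𝓐 (∑ i ∈ s, X i)) g).formal :=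
  (map_sum (AddMonoidHom.mk' (fun X => (𝒞.intOp (f * const 𝓐 X) g).formal) fun X Y => by
    rw [const, Matrix.map_add _ (map_add _), Matrix.mul_add, formal_intOp, fnMat_add,
      Matrix.add_mul, Matrix.add_mul]
    rfl) X s).symm

theorem formal_intOp_smul (c : ℂ) (f g : Matrix (Fin N) (Fin m) 𝓐) (X : Matrix (Fin m) (Fin m) ℂ) :
    (𝒞.intOp (f * const 𝓐 (c • X)) g).formal = c • (𝒞.intOp (f * const 𝓐 X) g).formal := by
  rw [const_smul, formal_intOp, formal_intOp, Matrix.mul_smul, fnMat_smul, Matrix.smul_mul,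
    Matrix.smul_mul]

/-- The dressed operator when `φ` and `ψ` span invariant subspaces. -/
theorem formal_dressed_of_eigen (hΔ : IsUnit (𝒞.Delta C φ ψ).det) {A : IntDiffOp 𝓐 N}
    {X Y : Matrix (Fin K) (Fin K) ℂ} (hX : A.act φ = φ * const 𝓐 X)
    (hY : A.actT ψ = ψ * const 𝓐 Y) :
    (𝒞.W C φ ψ * A * 𝒞.Winv C φ ψ).formal = 𝒞.dressedPart C φ ψ A +
      (𝒞.intOp (𝒞.Phi C φ ψ * const 𝓐 (C * X - Y.transpose * C)) (𝒞.Psi C φ ψ)).formal := by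
  have h1 : fnMat (𝒞.Phi C φ ψ) * scalarMat K (PDO.Dinv 𝒞.dx) *
      fnMat ((𝒞.Winv C φ ψ).actT (A.actT ψ)).transpose =
      (𝒞.intOp (𝒞.Phi C φ ψ * const 𝓐 (Y.transpose * C)) (𝒞.Psi C φ ψ)).formal := by
    have h := formal_intOp_mul_const (𝒞 := 𝒞) (𝒞.Phi C φ ψ) (𝒞.Psi C φ ψ) 1 (C.transpose * Y)
    rw [const_one, Matrix.mul_one, Matrix.one_mul, Matrix.transpose_mul,
      Matrix.transpose_transpose] at h
    rw [← h, hY, IntDiffOp.actT_mul_const, actT_Winv_self hΔ, Matrix.mul_assoc (𝒞.Psi C φ ψ),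
      ← const_mul]
    rfl
  rw [dressedPart_apply, h1, hX, IntDiffOp.act_mul_const, act_W_self hΔ,
    Matrix.mul_assoc (𝒞.Phi C φ ψ), ← const_mul, const_sub, Matrix.mul_sub, formal_intOp, formal_intOp, fnMat_sub, Matrix.sub_mul,
    Matrix.sub_mul, IntDiffOp.formal_mul, IntDiffOp.formal_mul]
  abel

variable (σ : 𝒞.Classes)

namespace Classes

/-- The operator preserves the right class, and its transpose the left class. -/
def Preserves (A : IntDiffOp 𝓐 N) : Prop :=
  ∀ (m : ℕ) (f : Matrix (Fin N) (Fin m) 𝓐),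
    (EntriesIn σ.right f → EntriesIn σ.right (A.act f)) ∧
    (EntriesIn σ.left f → EntriesIn σ.left (A.actT f))

variable {σ} {A B : IntDiffOp 𝓐 N}

theorem Preserves.sub (hA : σ.Preserves A) (hB : σ.Preserves B) : σ.Preserves (A - B) :=
  fun m f => ⟨fun hf => ((hA m f).1 hf).sub ((hB m f).1 hf),
    fun hf => ((hA m f).2 hf).sub ((hB m f).2 hf)⟩

theorem Preserves.smul (c : ℂ) (hA : σ.Preserves A) : σ.Preserves (c • A) :=
  fun m f => ⟨fun hf => ((hA m f).1 hf).smul c, fun hf => ((hA m f).2 hf).smul c⟩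

theorem Preserves.mul (hA : σ.Preserves A) (hB : σ.Preserves B) : σ.Preserves (A * B) :=
  fun m f => ⟨fun hf => (hA m _).1 ((hB m f).1 hf), fun hf => (hB m _).2 ((hA m f).2 hf)⟩

theorem preserves_one : σ.Preserves (1 : IntDiffOp 𝓐 N) := fun _ _ => ⟨id, id⟩

theorem Preserves.pow (hA : σ.Preserves A) (j : ℕ) : σ.Preserves (A ^ j) := by
  induction j with
  | zero => exact preserves_one
  | succ j ih => rw [pow_succ]; exact ih.mul hA

theorem preserves_sum {ι : Type*} (s : Finset ι) {X : ι → IntDiffOp 𝓐 N}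
    (hX : ∀ i ∈ s, σ.Preserves (X i)) : σ.Preserves (∑ i ∈ s, X i) := by
  refine Finset.sum_induction X σ.Preserves (fun A B hA hB m f => ?_) (fun m f => ?_) hX
  · exact ⟨fun hf => ((hA m f).1 hf).add ((hB m f).1 hf),
      fun hf => ((hA m f).2 hf).add ((hB m f).2 hf)⟩
  · exact ⟨fun _ _ _ => zero_mem _, fun _ _ _ => zero_mem _⟩

theorem preserves_mulFn {u : Matrix (Fin N) (Fin N) 𝓐} (hu : EntriesIn σ.coeffs u) :
    σ.Preserves (mulFn u) :=
  fun _ _ => ⟨fun hf => σ.coeff_mul_right hu hf, fun hf => σ.coeff_mul_left hu.transpose hf⟩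

theorem preserves_Dx : σ.Preserves (𝒞.Dx : IntDiffOp 𝓐 N) :=
  fun _ _ => ⟨fun hf => entriesIn_map σ.dx_right hf, fun hf => (entriesIn_map σ.dx_left hf).neg⟩

theorem preserves_Dτ : σ.Preserves (𝒞.Dτ : IntDiffOp 𝓐 N) :=
  fun _ _ => ⟨fun hf => entriesIn_map σ.dτ_right hf, fun hf => (entriesIn_map σ.dτ_left hf).neg⟩

theorem preserves_intOp {f g : Matrix (Fin N) (Fin m) 𝓐} (hf : EntriesIn σ.right f)
    (hg : EntriesIn σ.left g) : σ.Preserves (𝒞.intOp f g) := fun _ _ =>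
  ⟨fun h => σ.right_mul_coeff hf (σ.integrable_coeff (σ.int_integrable
      (σ.left_mul_right_mat hg.transpose h))),
    fun h => (σ.left_mul_coeff hg (σ.integrable_coeff (σ.int_integrable
      (σ.right_mul_left_mat hf.transpose h)))).neg⟩

theorem preserves_opL {k : ℕ} {u : Fin (k + 1) → Matrix (Fin N) (Fin N) 𝓐}
    (hu : ∀ j, EntriesIn σ.coeffs (u j)) {q r : Matrix (Fin N) (Fin m) 𝓐}
    (hq : EntriesIn σ.right q) (hr : EntriesIn σ.left r) (β : ℂ) (M₀ : Matrix (Fin m) (Fin m) ℂ) :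
    σ.Preserves (𝒞.opL β u q r M₀) :=
  ((preserves_Dτ.smul β).sub (preserves_sum _ fun j _ =>
    (preserves_mulFn (hu j)).mul (preserves_Dx.pow j))).sub
    (preserves_intOp (σ.right_mul_coeff hq (σ.const_coeff M₀)) hr)

end Classes

end Calculus

/-- Sums of the form occurring in the second dressed operator telescope. -/
theorem sum_pow_mul_commutator_mul_pow {R : Type*} [Ring R] (a b c : R) (l : ℕ) :
    ∑ j ∈ Finset.range (l + 1), a ^ j * (a * c - c * b) * b ^ (l - j) =
      a ^ (l + 1) * c - c * b ^ (l + 1) := by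
  -- The summand is the difference of consecutive values of $a^jcb^{l+1-j}$; the range of $j$ keeps
  -- the exponent subtraction untruncated.
  have h := Finset.sum_range_sub (fun j => a ^ j * c * b ^ (l + 1 - j)) (l + 1)
  simp only [Nat.sub_self, pow_zero, mul_one, one_mul, Nat.sub_zero] at h
  rw [← h]
  refine Finset.sum_congr rfl fun j hj => ?_
  have hj' : l + 1 - j = l - j + 1 := by have := Finset.mem_range.mp hj; omega
  rw [hj', Nat.add_sub_add_right, pow_succ, pow_succ', mul_sub, sub_mul]
  simp only [mul_assoc]

namespace Calculus

section Intertwining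

variable {σ : 𝒞.Classes} (hφ : EntriesIn σ.right φ) (hψ : EntriesIn σ.left ψ)
  (hΔ : IsUnit (𝒞.Delta C φ ψ).det) (hΔF : EntriesIn σ.coeffs (𝒞.Delta C φ ψ)⁻¹)
  {L : IntDiffOp 𝓐 N}
include hφ hψ hΔ hΔF

/-- Inner factors $W^{-1}W$ cancel only on the right class, hence the requirement that $L$ preserve
it: every $L^j\{f\}$ stays where `act_Winv_act_W` applies. -/
theorem act_pow_dressed (hL : σ.Preserves L) {f : Matrix (Fin N) (Fin m) 𝓐}
    (hf : EntriesIn σ.right f) (j : ℕ) :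
    ((𝒞.W C φ ψ * L * 𝒞.Winv C φ ψ) ^ j).act ((𝒞.W C φ ψ).act f) =
      (𝒞.W C φ ψ).act ((L ^ j).act f) := by
  induction j with
  | zero => rfl
  | succ j ih =>
    rw [pow_succ', IntDiffOp.act_mul, ih, IntDiffOp.act_mul, IntDiffOp.act_mul,
      σ.act_Winv_act_W hφ hψ hΔ hΔF ((hL.pow j m f).1 hf), pow_succ', IntDiffOp.act_mul]

theorem actT_pow_dressed (hL : σ.Preserves L) {g : Matrix (Fin N) (Fin m) 𝓐}
    (hg : EntriesIn σ.left g) (j : ℕ) :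
    ((𝒞.W C φ ψ * L * 𝒞.Winv C φ ψ) ^ j).actT ((𝒞.Winv C φ ψ).actT g) =
      (𝒞.Winv C φ ψ).actT ((L ^ j).actT g) := by
  induction j with
  | zero => rfl
  | succ j ih =>
    rw [pow_succ, IntDiffOp.actT_mul, ih, IntDiffOp.actT_mul, IntDiffOp.actT_mul,
      σ.actT_W_actT_Winv hφ hψ hΔ hΔF ((hL.pow j m g).2 hg), pow_succ, IntDiffOp.actT_mul]

/-- Nondegeneracy of $C$ enters here: $\Phi=W\{\varphi\}C^{-1}$, so $\Phi$ inherits the eigenvalue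
equation of $\varphi$ through the intertwining. -/
theorem act_dressed_Phi (hC : IsUnit C.det) {X : Matrix (Fin K) (Fin K) ℂ}
    (hX : L.act φ = φ * const 𝓐 X) :
    (𝒞.W C φ ψ * L * 𝒞.Winv C φ ψ).act (𝒞.Phi C φ ψ) =
      𝒞.Phi C φ ψ * const 𝓐 (C * X * C⁻¹) := by
  have h : 𝒞.Phi C φ ψ = (𝒞.W C φ ψ).act φ * const 𝓐 C⁻¹ := by
    rw [act_W_self hΔ, Matrix.mul_assoc, ← const_mul, Matrix.mul_nonsing_inv _ hC, const_one,
      Matrix.mul_one]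
  conv_lhs => rw [h]
  rw [IntDiffOp.act_mul_const, IntDiffOp.act_mul, IntDiffOp.act_mul,
    σ.act_Winv_act_W hφ hψ hΔ hΔF hφ, hX, IntDiffOp.act_mul_const, act_W_self hΔ]
  simp only [const_mul, Matrix.mul_assoc]

theorem actT_dressed_Psi (hC : IsUnit C.det) {Y : Matrix (Fin K) (Fin K) ℂ}
    (hY : L.actT ψ = ψ * const 𝓐 Y) :
    (𝒞.W C φ ψ * L * 𝒞.Winv C φ ψ).actT (𝒞.Psi C φ ψ) =
      𝒞.Psi C φ ψ * const 𝓐 (C⁻¹ * Y.transpose * C).transpose := by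
  have hC' : IsUnit C.transpose.det := by rwa [Matrix.det_transpose]
  have h : 𝒞.Psi C φ ψ = (𝒞.Winv C φ ψ).actT ψ * const 𝓐 (C.transpose)⁻¹ := by
    rw [actT_Winv_self hΔ, Matrix.mul_assoc, ← const_mul, Matrix.mul_nonsing_inv _ hC', const_one,
      Matrix.mul_one]
  conv_lhs => rw [h]
  rw [IntDiffOp.actT_mul_const, IntDiffOp.actT_mul, IntDiffOp.actT_mul,
    σ.actT_W_actT_Winv hφ hψ hΔ hΔF hψ, hY, IntDiffOp.actT_mul_const, actT_Winv_self hΔ]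
  simp only [Matrix.transpose_mul, Matrix.transpose_transpose, Matrix.transpose_nonsing_inv,
    const_mul, Matrix.mul_assoc]

/-- Put $a=CXC^{-1}$ and $b=C^{-1}Y^\top C$. Then $\Phi[j]=\Phi a^j$ and
$\Psi[l-j]^\top=b^{l-j}\Psi^\top$, and the middle matrix is $aC-Cb$. The constants collect into
$\sum_j a^j(aC-Cb)b^{l-j}$, which telescopes to $a^{l+1}C-Cb^{l+1}$; conjugation by $C$ turns this
into the stated difference. -/
theorem formal_bilinSum_Phi_Psi (hC : IsUnit C.det) {X Y : Matrix (Fin K) (Fin K) ℂ}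
    (hX : L.act φ = φ * const 𝓐 X) (hY : L.actT ψ = ψ * const 𝓐 Y) (l : ℕ) :
    (𝒞.bilinSum (𝒞.W C φ ψ * L * 𝒞.Winv C φ ψ) l (𝒞.Phi C φ ψ) (𝒞.Psi C φ ψ)
      (C * X - Y.transpose * C)).formal =
    (𝒞.intOp (𝒞.Phi C φ ψ * const 𝓐 (C * X ^ (l + 1) - (Y ^ (l + 1)).transpose * C))
      (𝒞.Psi C φ ψ)).formal := by
  have hs : SemiconjBy C X (C * X * C⁻¹) := by
    change C * X = C * X * C⁻¹ * C
    rw [Matrix.mul_assoc _ C⁻¹, Matrix.nonsing_inv_mul _ hC, Matrix.mul_one]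
  have ht : SemiconjBy C (C⁻¹ * Y.transpose * C) Y.transpose := by
    change C * (C⁻¹ * Y.transpose * C) = Y.transpose * C
    rw [← Matrix.mul_assoc, ← Matrix.mul_assoc, Matrix.mul_nonsing_inv _ hC, Matrix.one_mul]
  have hM : C * X - Y.transpose * C = C * X * C⁻¹ * C - C * (C⁻¹ * Y.transpose * C) :=
    congrArg₂ (· - ·) hs.eq ht.eq.symm
  have hX' := act_dressed_Phi hφ hψ hΔ hΔF hC hX
  have hY' := actT_dressed_Psi hφ hψ hΔ hΔF hC hY
  rw [(hs.pow_right (l + 1)).eq, Matrix.transpose_pow, ← (ht.pow_right (l + 1)).eq,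
    ← sum_pow_mul_commutator_mul_pow, ← formal_intOp_sum, bilinSum, IntDiffOp.formal_sum, hM]
  refine Finset.sum_congr rfl fun j _ => ?_
  rw [IntDiffOp.act_pow_of_eigen _ _ hX', IntDiffOp.actT_pow_of_eigen _ _ hY', Matrix.mul_assoc,
    ← const_mul, formal_intOp_mul_const, Matrix.transpose_pow, Matrix.transpose_transpose]

theorem dressedPart_bilinSum (hL : σ.Preserves L) {q r : Matrix (Fin N) (Fin m) 𝓐}
    (hq : EntriesIn σ.right q) (hr : EntriesIn σ.left r) (l : ℕ) (M₀ : Matrix (Fin m) (Fin m) ℂ) :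
    𝒞.dressedPart C φ ψ (𝒞.bilinSum L l q r M₀) =
      (𝒞.bilinSum (𝒞.W C φ ψ * L * 𝒞.Winv C φ ψ) l ((𝒞.W C φ ψ).act q)
        ((𝒞.Winv C φ ψ).actT r) M₀).formal := by
  rw [bilinSum, map_sum, bilinSum, IntDiffOp.formal_sum]
  refine Finset.sum_congr rfl fun j _ => ?_
  rw [σ.dressedPart_intOp hφ hψ (σ.right_mul_coeff ((hL.pow j m q).1 hq) (σ.const_coeff M₀))
    ((hL.pow (l - j) m r).2 hr), IntDiffOp.act_mul_const, act_pow_dressed hφ hψ hΔ hΔF hL hq,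
    actT_pow_dressed hφ hψ hΔ hΔF hL hr]

end Intertwining

end Calculus

end DressedOperators

/-! ### Commuting partial derivatives and the classes of a realisation -/

section Smooth

variable (Ω : TopologicalSpace.Opens (Fin 3 → ℝ))

theorem partialFn_apply (i : Fin 3) (f : smoothFns Ω) (p : Ω) :
    (pderiv Ω i f).1 p = fderiv ℝ (extZero Ω f) p (Pi.single i 1) := rfl

theorem pderiv_pderiv_apply (i j : Fin 3) (f : smoothFns Ω) (p : Ω) :
    (pderiv Ω i (pderiv Ω j f)).1 p =
      fderiv ℝ (fderiv ℝ (extZero Ω f)) p (Pi.single i 1) (Pi.single j 1) := by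
  have hd : DifferentiableAt ℝ (fderiv ℝ (extZero Ω f)) p :=
    (((show ContDiffOn ℝ ∞ (extZero Ω f) Ω from f.2).fderiv_of_isOpen (m := ∞) Ω.isOpen
      (by simp)).contDiffAt (Ω.isOpen.mem_nhds p.2)).differentiableAt (by simp)
  rw [partialFn_apply, fderiv_extZero_congr Ω
    (g := fun y => fderiv ℝ (extZero Ω f) y (Pi.single j 1)) (fun y hy => rfl),
    fderiv_clm_apply hd (differentiableAt_const _)]
  simp

/-- Partial derivatives of smooth functions commute. -/
theorem pderiv_comm (i j : Fin 3) (f : smoothFns Ω) :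
    pderiv Ω i (pderiv Ω j f) = pderiv Ω j (pderiv Ω i f) := by
  refine Subtype.ext (funext fun p => ?_)
  rw [pderiv_pderiv_apply, pderiv_pderiv_apply]
  have h : ContDiffAt ℝ ∞ (extZero Ω f) p :=
    (show ContDiffOn ℝ ∞ (extZero Ω f) Ω from f.2).contDiffAt (Ω.isOpen.mem_nhds p.2)
  -- Over the reals, second-order smoothness suffices for symmetry of the second derivative.
  exact (h.isSymmSndFDerivAt (by
    rw [minSmoothness_of_isRCLikeNormedField]; exact WithTop.coe_le_coe.2 (le_top : (2 : ℕ∞) ≤ ⊤))).eq _ _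

/-- The function classes of a realisation. -/
def Realisation.classes {Ω : TopologicalSpace.Opens (Fin 3 → ℝ)} (ρ : Realisation Ω) :
    ρ.calculus.Classes where
  coeff := ρ.coeff
  integrable := ρ.integrable
  right := ρ.right
  left := ρ.left
  integrable_le := ρ.integrable_le
  mul_integrable := ρ.mul_integrable
  mul_right := ρ.mul_right
  mul_left := ρ.mul_left
  left_mul_right := ρ.left_mul_right
  dτ_integrable := ρ.pderiv_integrable 1
  dt_integrable := ρ.pderiv_integrable 2
  dx_right := ρ.pderiv_right 0
  dτ_right := ρ.pderiv_right 1
  dt_right := ρ.pderiv_right 2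
  dx_left := ρ.pderiv_left 0
  dτ_left := ρ.pderiv_left 1
  dt_left := ρ.pderiv_left 2
  int_mem := ρ.int_mem
  dx_int := ρ.pderiv_int
  int_dx := ρ.int_pderiv
  dτ_dx := pderiv_comm Ω 1 0
  dt_dx := pderiv_comm Ω 2 0

end Smooth

/-! ### Assembly of the dressed operators -/

section Theorem

variable {𝓐 : Type*} [CommRing 𝓐] [Algebra ℂ 𝓐] {𝒞 : Calculus 𝓐} {N K m : ℕ}
  {C : Matrix (Fin K) (Fin K) ℂ} {φ ψ : Matrix (Fin N) (Fin K) 𝓐}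

namespace Calculus

open Classical in
/-- The coefficients of the differential part of `W (∑ u_j D^j) W^{-1}`. -/
def dressCoeffs (𝒞 : Calculus 𝓐) (C : Matrix (Fin K) (Fin K) ℂ) (φ ψ : Matrix (Fin N) (Fin K) 𝓐)
    (k : ℕ) (u : Fin (k + 1) → Matrix (Fin N) (Fin N) 𝓐) :
    Fin (k + 1) → Matrix (Fin N) (Fin N) 𝓐 :=
  -- The choice sees only the calculus, $C$, $\varphi$, $\psi$ and the coefficients $u$, which gives
  -- the claimed dependence. The default $0$ is never reached under the hypotheses of
  -- `dressedPart_diffOp`.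
  if h : ∃ w : Fin (k + 1) → Matrix (Fin N) (Fin N) 𝓐,
      𝒞.dressedPart C φ ψ (𝒞.diffOp u) = (𝒞.diffOp w).formal then h.choose else 0

variable {σ : 𝒞.Classes} (hφ : EntriesIn σ.right φ) (hψ : EntriesIn σ.left ψ)
  (hΔ : IsUnit (𝒞.Delta C φ ψ).det) (hΔF : EntriesIn σ.coeffs (𝒞.Delta C φ ψ)⁻¹)

include hφ hψ

theorem dressedPart_diffOp {k : ℕ} {u : Fin (k + 1) → Matrix (Fin N) (Fin N) 𝓐}
    (hu : ∀ j, EntriesIn σ.coeffs (u j)) :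
    𝒞.dressedPart C φ ψ (𝒞.diffOp u) = (𝒞.diffOp (𝒞.dressCoeffs C φ ψ k u)).formal := by
  have h := σ.exists_dressedPart_diffOp (C := C) hφ hψ hu
  rw [dressCoeffs, dif_pos h]
  exact h.choose_spec

include hΔ

theorem dressedPart_Dτ : 𝒞.dressedPart C φ ψ 𝒞.Dτ = (𝒞.Dτ : IntDiffOp 𝓐 N).formal :=
  σ.dressedPart_evolution hφ hψ hΔ σ.dτ_dx σ.dτ_integrable σ.dτ_right
    (PDO.coeffwise_isLeibniz _ _) (PDO.coeffwise_commute_D _ _ σ.dτ_dx _) (formal_Dτ 𝒞)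
    (act_Dτ 𝒞 φ) (actT_Dτ 𝒞 ψ)

theorem dressedPart_Dt : 𝒞.dressedPart C φ ψ 𝒞.Dt = (𝒞.Dt : IntDiffOp 𝓐 N).formal :=
  σ.dressedPart_evolution hφ hψ hΔ σ.dt_dx σ.dt_integrable σ.dt_right
    (PDO.coeffwise_isLeibniz _ _) (PDO.coeffwise_commute_D _ _ σ.dt_dx _) (formal_Dt 𝒞)
    (act_Dt 𝒞 φ) (actT_Dt 𝒞 ψ)

/-- The dressed operator `W L W^{-1}`. -/
theorem formal_dressed_opL {k : ℕ} {u : Fin (k + 1) → Matrix (Fin N) (Fin N) 𝓐}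
    (hu : ∀ j, EntriesIn σ.coeffs (u j)) {q r : Matrix (Fin N) (Fin m) 𝓐}
    (hq : EntriesIn σ.right q) (hr : EntriesIn σ.left r) {β : ℂ}
    {M₀ : Matrix (Fin m) (Fin m) ℂ} {X Y : Matrix (Fin K) (Fin K) ℂ}
    (hX : (𝒞.opL β u q r M₀).act φ = φ * const 𝓐 X)
    (hY : (𝒞.opL β u q r M₀).actT ψ = ψ * const 𝓐 Y) :
    (𝒞.W C φ ψ * 𝒞.opL β u q r M₀ * 𝒞.Winv C φ ψ).formal =
      (β • (𝒞.Dτ : IntDiffOp 𝓐 N) - 𝒞.diffOp (𝒞.dressCoeffs C φ ψ k u)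
        - 𝒞.intOp ((𝒞.W C φ ψ).act q * const 𝓐 M₀) ((𝒞.Winv C φ ψ).actT r)
        + 𝒞.intOp (𝒞.Phi C φ ψ * const 𝓐 (C * X - Y.transpose * C)) (𝒞.Psi C φ ψ)).formal := by
  rw [formal_dressed_of_eigen hΔ hX hY, IntDiffOp.formal_add, opL, map_sub, map_sub, map_smul,
    dressedPart_Dτ hφ hψ hΔ, dressedPart_diffOp hφ hψ hu,
    σ.dressedPart_intOp hφ hψ (σ.right_mul_coeff hq (σ.const_coeff M₀)) hr,
    IntDiffOp.act_mul_const]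
  rfl

include hΔF

/-- The dressed operator `W M W^{-1}`. -/
theorem formal_dressed_opM (hC : IsUnit C.det) {L : IntDiffOp 𝓐 N} (hL : σ.Preserves L) {n : ℕ}
    {v : Fin (n + 1) → Matrix (Fin N) (Fin N) 𝓐}
    (hv : ∀ j, EntriesIn σ.coeffs (v j)) {q r : Matrix (Fin N) (Fin m) 𝓐}
    (hq : EntriesIn σ.right q) (hr : EntriesIn σ.left r) {α c : ℂ} {l : ℕ}
    {M₀ : Matrix (Fin m) (Fin m) ℂ} {X Y : Matrix (Fin K) (Fin K) ℂ}
    (hX : L.act φ = φ * const 𝓐 X) (hY : L.actT ψ = ψ * const 𝓐 Y)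
    (hMX : (𝒞.opM L l α c v q r M₀).act φ = c • (φ * const 𝓐 (X ^ (l + 1))))
    (hMY : (𝒞.opM L l α c v q r M₀).actT ψ = c • (ψ * const 𝓐 (Y ^ (l + 1)))) :
    (𝒞.W C φ ψ * 𝒞.opM L l α c v q r M₀ * 𝒞.Winv C φ ψ).formal =
      (α • (𝒞.Dt : IntDiffOp 𝓐 N) - 𝒞.diffOp (𝒞.dressCoeffs C φ ψ n v)
        - c • 𝒞.bilinSum (𝒞.W C φ ψ * L * 𝒞.Winv C φ ψ) l ((𝒞.W C φ ψ).act q)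
          ((𝒞.Winv C φ ψ).actT r) M₀
        + c • 𝒞.bilinSum (𝒞.W C φ ψ * L * 𝒞.Winv C φ ψ) l (𝒞.Phi C φ ψ) (𝒞.Psi C φ ψ)
          (C * X - Y.transpose * C)).formal := by
  have hs : ∀ (f : Matrix (Fin N) (Fin K) 𝓐) (Z : Matrix (Fin K) (Fin K) ℂ),
      c • (f * const 𝓐 Z) = f * const 𝓐 (c • Z) := by
    intro f Z
    rw [const_smul, Matrix.mul_smul]
  rw [hs] at hMX hMY
  have hc : C * c • X ^ (l + 1) - (c • Y ^ (l + 1)).transpose * C =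
      c • (C * X ^ (l + 1) - (Y ^ (l + 1)).transpose * C) := by
    rw [Matrix.transpose_smul, Matrix.mul_smul, Matrix.smul_mul, smul_sub]
  -- The correction with $c(CX^{l+1}-(Y^{l+1})^\top C)$ is expanded into the sum over $\Phi[s]$ and
  -- $\Psi[l-s]$ by reading the telescoping identity backwards.
  rw [formal_dressed_of_eigen hΔ hMX hMY, hc, formal_intOp_smul,
    ← formal_bilinSum_Phi_Psi hφ hψ hΔ hΔF hC hX hY, IntDiffOp.formal_add, opM, map_sub, map_sub,
    map_smul, map_smul, dressedPart_Dt hφ hψ hΔ, dressedPart_diffOp hφ hψ hv,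
    dressedPart_bilinSum hφ hψ hΔ hΔF hL hq hr]
  rfl

omit hΔF

/-- Since $W$ and $W^{-1}$ are formal inverses, conjugation respects powers as well as linear
combinations; no eigenvalue equation is involved. -/
theorem formal_dressed_sub_pow (A L : IntDiffOp 𝓐 N) (c : ℂ) (l : ℕ) :
    (𝒞.W C φ ψ * (A - c • L ^ l) * 𝒞.Winv C φ ψ).formal =
      (𝒞.W C φ ψ * A * 𝒞.Winv C φ ψ - c • (𝒞.W C φ ψ * L * 𝒞.Winv C φ ψ) ^ l).formal := by
  have h1 := σ.formal_W_mul_Winv hφ hψ hΔ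
  have h2 := σ.formal_Winv_mul_W hφ hψ hΔ
  have hpow : ∀ l : ℕ, ((𝒞.W C φ ψ).formal * L.formal * (𝒞.Winv C φ ψ).formal) ^ l =
      (𝒞.W C φ ψ).formal * L.formal ^ l * (𝒞.Winv C φ ψ).formal := by
    intro l
    induction l with
    | zero => rw [pow_zero, pow_zero, mul_one, h1]
    | succ l ih =>
      rw [pow_succ, ih, pow_succ, mul_assoc, mul_assoc (𝒞.W C φ ψ).formal L.formal,
        ← mul_assoc (𝒞.Winv C φ ψ).formal, h2, one_mul]
      simp only [mul_assoc]
  simp only [IntDiffOp.formal_mul, IntDiffOp.formal_sub, IntDiffOp.formal_smul,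
    IntDiffOp.formal_pow, hpow, mul_sub, sub_mul, mul_smul_comm, smul_mul_assoc]

end Calculus

end Theorem

end BDT

end

/-! ### The theorem for a realisation on $\Omega$ -/

open BDT in
theorem theorem3 (Ω : TopologicalSpace.Opens (Fin 3 → ℝ)) (ρ : Realisation Ω) (N K : ℕ)
    (φ ψ : Matrix (Fin N) (Fin K) (smoothFns Ω))
    (hφ : ∀ i j, φ i j ∈ ρ.right) (hψ : ∀ i j, ψ i j ∈ ρ.left)
    (C : Matrix (Fin K) (Fin K) ℂ) (hC : IsUnit C.det)
    (hΔ : IsUnit (ρ.calculus.Delta C φ ψ).det)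
    (hΔF : ∀ i j, (ρ.calculus.Delta C φ ψ)⁻¹ i j ∈ ρ.coeff) :
    let 𝒞 := ρ.calculus
    let W := 𝒞.W C φ ψ
    let Winv := 𝒞.Winv C φ ψ
    let Φ := 𝒞.Phi C φ ψ
    let Ψ := 𝒞.Psi C φ ψ
    W.formal * Winv.formal = 1 ∧ Winv.formal * W.formal = 1 ∧
    -- the dressed coefficients depend only on `φ`, `ψ`, `C` and the original coefficients
    ∃ dress : ∀ p : ℕ, (Fin (p + 1) → Matrix (Fin N) (Fin N) (smoothFns Ω)) →
        (Fin (p + 1) → Matrix (Fin N) (Fin N) (smoothFns Ω)),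
      ∀ (m k n l : ℕ) (α β c : ℂ)
        (u : Fin (k + 1) → Matrix (Fin N) (Fin N) (smoothFns Ω))
        (v : Fin (n + 1) → Matrix (Fin N) (Fin N) (smoothFns Ω))
        (q r : Matrix (Fin N) (Fin m) (smoothFns Ω))
        (M₀ : Matrix (Fin m) (Fin m) ℂ) (Λ Λ' : Matrix (Fin K) (Fin K) ℂ),
      (∀ a i j, u a i j ∈ ρ.coeff) → (∀ a i j, v a i j ∈ ρ.coeff) →
      (∀ i j, q i j ∈ ρ.right) → (∀ i j, r i j ∈ ρ.left) →
      let L := 𝒞.opL β u q r M₀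
      let M := 𝒞.opM L l α c v q r M₀
      L.act φ = φ * const (smoothFns Ω) Λ →
      L.actT ψ = ψ * const (smoothFns Ω) Λ' →
      M.act φ = c • (φ * const (smoothFns Ω) (Λ ^ (l + 1))) →
      M.actT ψ = c • (ψ * const (smoothFns Ω) (Λ' ^ (l + 1))) →
      let Lhat := W * L * Winv
      let Mhat := W * M * Winv
      let Mtilde := M - c • L ^ (l + 1)
      let qhat := W.act q
      let rhat := Winv.actT r
      let M₁ := C * Λ - Λ'.transpose * C
      Lhat.formal = (β • (𝒞.Dτ : IntDiffOp (smoothFns Ω) N) - 𝒞.diffOp (dress k u)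
          - 𝒞.intOp (qhat * const (smoothFns Ω) M₀) rhat
          + 𝒞.intOp (Φ * const (smoothFns Ω) M₁) Ψ).formal ∧
      Mhat.formal = (α • (𝒞.Dt : IntDiffOp (smoothFns Ω) N) - 𝒞.diffOp (dress n v) - c • 𝒞.bilinSum Lhat l qhat rhat M₀
          + c • 𝒞.bilinSum Lhat l Φ Ψ M₁).formal ∧
      (W * Mtilde * Winv).formal = (Mhat - c • Lhat ^ (l + 1)).formal := by
  intro 𝒞 W Winv Φ Ψ
  let σ := ρ.classes
  have hφ' : EntriesIn σ.right φ := hφ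
  have hψ' : EntriesIn σ.left ψ := hψ
  have hΔF' : EntriesIn σ.coeffs (𝒞.Delta C φ ψ)⁻¹ := hΔF
  -- The coefficient map is supplied before $u$, $v$, $\mathbf q$, $\mathbf r$ and the spectral
  -- matrices are introduced, so one map serves both $L$ and $M$.
  refine ⟨σ.formal_W_mul_Winv hφ' hψ' hΔ, σ.formal_Winv_mul_W hφ' hψ' hΔ,
    𝒞.dressCoeffs C φ ψ, ?_⟩
  intro m k n l α β c u v q r M₀ Λ Λ' hu hv hq hr L M hLφ hLψ hMφ hMψ
  have hL : σ.Preserves L := Calculus.Classes.preserves_opL (σ := σ) hu hq hr β M₀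
  exact ⟨Calculus.formal_dressed_opL (σ := σ) hφ' hψ' hΔ hu hq hr hLφ hLψ,
    Calculus.formal_dressed_opM (σ := σ) hφ' hψ' hΔ hΔF' hC hL hv hq hr hLφ hLψ hMφ hMψ,
    Calculus.formal_dressed_sub_pow (σ := σ) hφ' hψ' hΔ M L c (l + 1)⟩
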